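/- Let $D\ge 1$, let $L\subset\mathbb R^D$ be a ($\mathbb Z$-)lattice of full rank, let $0\le\alpha<D$, and let $\delta>0$, $\kappa>0$ and $m\in\mathbb N$. Then there is a constant $c>0$, depending only on $D,L,\alpha,\delta,\kappa,m$, such that the following holds. Let $\Lambda\subset L$ be any finite set of $N$ sites, with a finite-dimensional spin at each site (of arbitrary, possibly site-dependent, dimension), and let $$H(t)=\sum_{i\in\Lambda}h_i(t)+\sum_{\{i,j\}\subset\Lambda,\ i\ne j}h_{ij}(t)\qquad(t\ge 0),$$ where $h_i(t)$ and $h_{ij}(t)$ are self-adjoint operators, supported on $\{i\}$ and on $\{i,j\}$ respectively and integrable in $t$ on bounded intervals, and $\|h_{ij}(t)\|\le 1/r_{ij}^{\alpha}$ with $r_{ij}$ the Euclidean distance; the on-site terms $h_i(t)$ may be arbitrarily strong. Write $A(t)=U(t)^\dagger A\,U(t)$ with $U(t)=\mathcal T e^{-i\int_0^tH(s)\,ds}$, and let $X,Y\subset\Lambda$ satisfy $|X|,|Y|\le m$ and $r_{xy}\ge\kappa N^{1/D}$ for all $x\in X$, $y\in Y$. Define the signaling time $t_{\mathrm{si}}\in[0,\infty]$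 as the infimum of all $t\ge 0$ for which there are operators $A$ and $B$, supported on $X$ and $Y$ respectively, with $\|A\|=\|B\|=1$ and $\|[A(t),B]\|>\delta$. Then $$t_{\mathrm{si}}\;\ge\;c\,\frac{\log N}{N^{1-\alpha/D}}.$$ In particular, $t_{\mathrm{si}}=\Omega\!\left(\log(N)/N^{1-\alpha/D}\right)$ as $N\to\infty$. -/

import Mathlib

open scoped Matrix.Norms.L2Operator NNReal ENNReal

noncomputable section

namespace LongRange

/-- Configurations of a spin system on the sites `V`, the spin at site `i` having `d i` levels.
They index the standard basis of the Hilbert space `⨂ i, ℂ^(d i)`. -/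
abbrev Config {V : Type*} (d : V → ℕ) : Type _ := (i : V) → Fin (d i)

/-- Operators on the Hilbert space `⨂ i, ℂ^(d i)`, as matrices in the standard basis. The norm is
the operator norm of the Euclidean (Hilbert space) norm. -/
abbrev Op {V : Type*} (d : V → ℕ) : Type _ := Matrix (Config d) (Config d) ℂ

/-- `A` is supported on the set of sites `X`: it has the form `a ⊗ 1`, with `a` acting on the
spins in `X` and `1` the identity on the spins outside `X`. -/
def SupportedOn {V : Type*} [Fintype V] [DecidableEq V] {d : V → ℕ} (X : Finset V) (A : Op d) :
    Prop :=
  ∃ a : Matrix ((i : X) → Fin (d i)) ((i : X) → Fin (d i)) ℂ, ∀ s s' : Config d,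
    A s s' = if ∀ i, i ∉ X → s i = s' i then a (fun i => s i) (fun i => s' i) else 0

/-- The terms of the Dyson series:
`(-i)^n ∫_{0 ≤ t₁ ≤ ⋯ ≤ tₙ ≤ t} H(tₙ) ⋯ H(t₁)`, written as iterated integrals. -/
def dysonTerm {V : Type*} [Fintype V] [DecidableEq V] {d : V → ℕ} (H : ℝ → Op d) :
    ℕ → ℝ → Op d
  | 0, _ => 1
  | n + 1, t => (-Complex.I) • ∫ s in (0 : ℝ)..t, H s * dysonTerm H n s

/-- The time evolution operator `U(t) = 𝒯 exp (-i ∫₀ᵗ H(s) ds)`, with `ħ = 1`. -/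
def timeEvolution {V : Type*} [Fintype V] [DecidableEq V] {d : V → ℕ} (H : ℝ → Op d) (t : ℝ) :
    Op d :=
  ∑' n : ℕ, dysonTerm H n t

/-- The operator `A` in the Heisenberg picture: `A(t) = U(t)† A U(t)`. -/
def heisenberg {V : Type*} [Fintype V] [DecidableEq V] {d : V → ℕ} (H : ℝ → Op d) (A : Op d)
    (t : ℝ) : Op d :=
  star (timeEvolution H t) * A * timeEvolution H t

/-- A time-dependent spin Hamiltonian with on-site terms and two-body interactions
of strength at most `1 / r ^ α` at distance `r`. -/
structure PowerLawHamiltonian {V : Type*} [Fintype V] [DecidableEq V] [Dist V] (d : V → ℕ)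
    (α : ℝ) where
  /-- the on-site terms, of arbitrary strength -/
  onsite : V → ℝ → Op d
  /-- the interactions `h_{ij}(t)`, indexed by unordered pairs (diagonal pairs are not used) -/
  pair : Sym2 V → ℝ → Op d
  onsite_selfAdjoint : ∀ i, ∀ t, 0 ≤ t → IsSelfAdjoint (onsite i t)
  onsite_supported : ∀ i, ∀ t, 0 ≤ t → SupportedOn {i} (onsite i t)
  onsite_integrable : ∀ i, ∀ T, 0 ≤ T → IntervalIntegrable (onsite i) MeasureTheory.volume 0 T
  pair_selfAdjoint : ∀ i j, i ≠ j → ∀ t, 0 ≤ t → IsSelfAdjoint (pair s(i, j) t)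
  pair_supported : ∀ i j, i ≠ j → ∀ t, 0 ≤ t → SupportedOn {i, j} (pair s(i, j) t)
  pair_integrable : ∀ i j, i ≠ j → ∀ T, 0 ≤ T →
    IntervalIntegrable (pair s(i, j)) MeasureTheory.volume 0 T
  pair_norm_le : ∀ i j, i ≠ j → ∀ t, 0 ≤ t → ‖pair s(i, j) t‖ ≤ 1 / dist i j ^ α

/-- The total Hamiltonian `H(t) = ∑ᵢ hᵢ(t) + ∑_{i<j} h_{ij}(t)`. -/
def PowerLawHamiltonian.total {V : Type*} [Fintype V] [DecidableEq V] [Dist V] {d : V → ℕ}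
    {α : ℝ} (h : PowerLawHamiltonian d α) (t : ℝ) : Op d :=
  ∑ i, h.onsite i t + ∑ e : Sym2 V with ¬ e.IsDiag, h.pair e t

/-- At time `t` a signal of strength more than `δ` can be sent between `X` and `Y`: there are
unit-norm operators `A`, `B` supported on `X`, `Y` with `‖[A(t), B]‖ > δ`. -/
def CanSignal {V : Type*} [Fintype V] [DecidableEq V] {d : V → ℕ} (H : ℝ → Op d)
    (X Y : Finset V) (δ : ℝ) (t : ℝ) : Prop :=
  ∃ A B : Op d, SupportedOn X A ∧ SupportedOn Y B ∧ ‖A‖ = 1 ∧ ‖B‖ = 1 ∧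
    δ < ‖heisenberg H A t * B - B * heisenberg H A t‖

/-- The signaling time: the infimum of the times `t ≥ 0` at which signaling from `X` to `Y` with
threshold `δ` is possible (`∞` if there is none). -/
def signalingTime {V : Type*} [Fintype V] [DecidableEq V] {d : V → ℕ} (H : ℝ → Op d)
    (X Y : Finset V) (δ : ℝ) : ℝ≥0∞ :=
  ⨅ (t : ℝ≥0) (_ : CanSignal H X Y δ t), (t : ℝ≥0∞)

end LongRange

end

section Calculus

open MeasureTheory Set

/-- `F` is on `[0, T]` the primitive of the integrable function `f`. -/
structure IsPrimitiveOn {E : Type*} [NormedAddCommGroup E] [NormedSpace ℝ E] (F f : ℝ → E)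
    (T : ℝ) : Prop where
  intervalIntegrable : IntervalIntegrable f volume 0 T
  eq_integral : ∀ t ∈ Icc 0 T, F t = F 0 + ∫ s in (0 : ℝ)..t, f s

namespace IsPrimitiveOn

section NormedSpace

variable {E E' : Type*} [NormedAddCommGroup E] [NormedSpace ℝ E] [NormedAddCommGroup E']
  [NormedSpace ℝ E'] {F G f g : ℝ → E} {T : ℝ}

theorem continuousOn (h : IsPrimitiveOn F f T) (hT : 0 ≤ T) : ContinuousOn F (Icc 0 T) := by
  have h1 := intervalIntegral.continuousOn_primitive_interval (a := 0) (b := T) (f := f)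
    (μ := volume) (by
      rw [uIcc_of_le hT]
      exact (intervalIntegrable_iff_integrableOn_Icc_of_le hT).1 h.intervalIntegrable)
  rw [uIcc_of_le hT] at h1
  exact (continuousOn_const.add h1).congr h.eq_integral

theorem congr_right (h : IsPrimitiveOn F f T) (hT : 0 ≤ T) (hfg : ∀ t ∈ Icc 0 T, f t = g t) :
    IsPrimitiveOn F g T where
  intervalIntegrable := by
    have h1 := h.intervalIntegrable
    rw [intervalIntegrable_iff_integrableOn_Icc_of_le hT] at h1 ⊢
    exact h1.congr_fun hfg measurableSet_Icc
  eq_integral t ht := by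
    rw [h.eq_integral t ht]
    congr 1
    refine intervalIntegral.integral_congr fun s hs => ?_
    rw [uIcc_of_le ht.1] at hs
    exact hfg s ⟨hs.1, hs.2.trans ht.2⟩

theorem mono (h : IsPrimitiveOn F f T) {S : ℝ} (hS : S ∈ Icc 0 T) : IsPrimitiveOn F f S where
  intervalIntegrable := h.intervalIntegrable.mono_set (by
    rw [uIcc_of_le hS.1, uIcc_of_le (hS.1.trans hS.2)]; exact Icc_subset_Icc_right hS.2)
  eq_integral t ht := h.eq_integral t ⟨ht.1, ht.2.trans hS.2⟩

theorem map (h : IsPrimitiveOn F f T) [CompleteSpace E] [CompleteSpace E'] (L : E →L[ℝ] E') :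
    IsPrimitiveOn (fun t => L (F t)) (fun t => L (f t)) T where
  intervalIntegrable := ⟨L.integrable_comp h.intervalIntegrable.1,
    L.integrable_comp h.intervalIntegrable.2⟩
  eq_integral t ht := by
    rw [h.eq_integral t ht, map_add, L.intervalIntegral_comp_comm
      (h.mono ht).intervalIntegrable]

theorem const (x : E) (T : ℝ) : IsPrimitiveOn (fun _ => x) (fun _ => (0 : E)) T where
  intervalIntegrable := by simp
  eq_integral t ht := by simp

theorem of_integral (hf : IntervalIntegrable f volume 0 T) (x : E) :
    IsPrimitiveOn (fun t => x + ∫ s in (0 : ℝ)..t, f s) f T where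
  intervalIntegrable := hf
  eq_integral t ht := by simp

theorem norm_le (h : IsPrimitiveOn F f T) {t : ℝ} (ht : t ∈ Icc 0 T) :
    ‖F t‖ ≤ ‖F 0‖ + ∫ s in (0 : ℝ)..t, ‖f s‖ := by
  rw [h.eq_integral t ht]
  exact (norm_add_le _ _).trans (by
    gcongr; exact intervalIntegral.norm_integral_le_integral_norm ht.1)

theorem eq_zero_apply (h : IsPrimitiveOn F f T) (hf : ∀ t ∈ Icc 0 T, f t = 0) {t : ℝ}
    (ht : t ∈ Icc 0 T) : F t = F 0 := by
  rw [h.eq_integral t ht, intervalIntegral.integral_congr (g := fun _ => 0), 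
    intervalIntegral.integral_zero, add_zero]
  intro s hs
  rw [uIcc_of_le ht.1] at hs
  exact hf s ⟨hs.1, hs.2.trans ht.2⟩

end NormedSpace

section NormedRing

variable {E : Type*} [NormedRing E] [NormedAlgebra ℝ E] {F G f g : ℝ → E}
  {T : ℝ}

theorem integral_mul_integral_eq_add (hT : 0 ≤ T) (hf : IntervalIntegrable f volume 0 T)
    (hg : IntervalIntegrable g volume 0 T) :
    (∫ s in (0 : ℝ)..T, f s) * ∫ s in (0 : ℝ)..T, g s =
      (∫ s in (0 : ℝ)..T, f s * ∫ r in (0 : ℝ)..s, g r) +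
        ∫ r in (0 : ℝ)..T, (∫ s in (0 : ℝ)..r, f s) * g r := by
  set μ : Measure ℝ := volume.restrict (Ioc 0 T) with hμ
  have hf' : Integrable f μ := (intervalIntegrable_iff_integrableOn_Ioc_of_le hT).1 hf
  have hg' : Integrable g μ := (intervalIntegrable_iff_integrableOn_Ioc_of_le hT).1 hg
  have hfg : Integrable (fun z : ℝ × ℝ => f z.1 * g z.2) (μ.prod μ) := hf'.mul_prod hg'
  have hmeas : MeasurableSet {z : ℝ × ℝ | z.2 ≤ z.1} :=
    measurableSet_le measurable_snd measurable_fst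
  have hlower : ∫ s in (0 : ℝ)..T, f s * ∫ r in (0 : ℝ)..s, g r =
      ∫ s, ∫ r, {z : ℝ × ℝ | z.2 ≤ z.1}.indicator (fun z => f z.1 * g z.2) (s, r) ∂μ ∂μ := by
    rw [intervalIntegral.integral_of_le hT]
    refine setIntegral_congr_fun measurableSet_Ioc fun s hs => ?_
    have hind : ∀ r, {z : ℝ × ℝ | z.2 ≤ z.1}.indicator (fun z => f z.1 * g z.2) (s, r) =
        f s * (Iic s).indicator g r := by
      intro r
      by_cases h : r ≤ s <;> simp [indicator, h]
    simp only [hind]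
    rw [integral_const_mul_of_integrable (hg'.indicator measurableSet_Iic),
      integral_indicator measurableSet_Iic,
      hμ, Measure.restrict_restrict measurableSet_Iic, intervalIntegral.integral_of_le hs.1.le]
    congr 4
    ext r
    simp only [mem_Ioc, mem_inter_iff, mem_Iic]
    exact ⟨fun h => ⟨h.2, h.1, h.2.trans hs.2⟩, fun h => ⟨h.2.1, h.1⟩⟩
  have hupper : ∫ r in (0 : ℝ)..T, (∫ s in (0 : ℝ)..r, f s) * g r =
      ∫ s, ∫ r, {z : ℝ × ℝ | z.2 ≤ z.1}ᶜ.indicator (fun z => f z.1 * g z.2) (s, r) ∂μ ∂μ := by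
    have hswap := integral_integral_swap (f := fun s r =>
      {z : ℝ × ℝ | z.2 ≤ z.1}ᶜ.indicator (fun z => f z.1 * g z.2) (s, r))
      (hfg.indicator hmeas.compl)
    rw [hswap, intervalIntegral.integral_of_le hT]
    refine setIntegral_congr_fun measurableSet_Ioc fun r hr => ?_
    have hind : ∀ s, {z : ℝ × ℝ | z.2 ≤ z.1}ᶜ.indicator (fun z => f z.1 * g z.2) (s, r) =
        (Iio r).indicator f s * g r := by
      intro s
      by_cases h : r ≤ s
      · simp [indicator, h, not_lt.2 h]
      · simp [indicator, h, not_le.1 h]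
    simp only [hind]
    rw [integral_mul_const_of_integrable (hf'.indicator measurableSet_Iio),
      integral_indicator measurableSet_Iio,
      hμ, Measure.restrict_restrict measurableSet_Iio, intervalIntegral.integral_of_le hr.1.le,
      integral_Ioc_eq_integral_Ioo]
    congr 4
    ext s
    simp only [mem_Ioo, mem_Ioc, mem_inter_iff, mem_Iio]
    exact ⟨fun h => ⟨h.2, h.1, h.2.le.trans hr.2⟩, fun h => ⟨h.2.1, h.1⟩⟩
  rw [hlower, hupper, ← integral_prod _ (hfg.indicator hmeas),
    ← integral_prod _ (hfg.indicator hmeas.compl),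
    ← integral_add (hfg.indicator hmeas) (hfg.indicator hmeas.compl)]
  simp only [indicator_self_add_compl_apply]
  rw [integral_prod _ hfg, intervalIntegral.integral_of_le hT, intervalIntegral.integral_of_le hT,
    ← integral_mul_const_of_integrable hf']
  refine integral_congr_ae (ae_of_all _ fun s => ?_)
  exact (integral_const_mul_of_integrable hg').symm

/-- The product rule. -/
theorem mul [CompleteSpace E] (hF : IsPrimitiveOn F f T) (hG : IsPrimitiveOn G g T) (hT : 0 ≤ T) :
    IsPrimitiveOn (fun t => F t * G t) (fun t => f t * G t + F t * g t) T := by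
  have hFc := hF.continuousOn hT
  have hGc := hG.continuousOn hT
  rw [← uIcc_of_le hT] at hFc hGc
  refine ⟨(hF.intervalIntegrable.mul_continuousOn hGc).add
    (hG.intervalIntegrable.continuousOn_mul hFc), fun t ht => ?_⟩
  have hft := (hF.mono ht).intervalIntegrable
  have hgt := (hG.mono ht).intervalIntegrable
  have hpf := ((of_integral hft 0).continuousOn ht.1)
  have hpg := ((of_integral hgt 0).continuousOn ht.1)
  rw [← uIcc_of_le ht.1] at hpf hpg
  simp only [zero_add] at hpf hpg
  have hsplit : ∫ s in (0 : ℝ)..t, (f s * G s + F s * g s) =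
      ∫ s in (0 : ℝ)..t, ((f s * G 0 + F 0 * g s) +
        (f s * (∫ r in (0 : ℝ)..s, g r) + (∫ r in (0 : ℝ)..s, f r) * g s)) := by
    refine intervalIntegral.integral_congr fun s hs => ?_
    rw [uIcc_of_le ht.1] at hs
    have hs' : s ∈ Icc 0 T := ⟨hs.1, hs.2.trans ht.2⟩
    rw [hF.eq_integral s hs', hG.eq_integral s hs']
    noncomm_ring
  have hi1 := hft.mul_const (G 0)
  have hi2 := hgt.const_mul (F 0)
  have hi3 := hft.mul_continuousOn hpg
  have hi4 := hgt.continuousOn_mul hpf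
  rw [hsplit, intervalIntegral.integral_add (hi1.add hi2) (hi3.add hi4),
    intervalIntegral.integral_add hi1 hi2, intervalIntegral.integral_add hi3 hi4,
    ← integral_mul_integral_eq_add ht.1 hft hgt]
  have h1 : ∫ s in (0 : ℝ)..t, f s * G 0 = (∫ s in (0 : ℝ)..t, f s) * G 0 :=
    (((ContinuousLinearMap.mul ℝ E).flip (G 0)).intervalIntegral_comp_comm hft)
  have h2 : ∫ s in (0 : ℝ)..t, F 0 * g s = F 0 * ∫ s in (0 : ℝ)..t, g s :=
    ((ContinuousLinearMap.mul ℝ E (F 0)).intervalIntegral_comp_comm hgt)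
  rw [h1, h2, hF.eq_integral t ht, hG.eq_integral t ht]
  noncomm_ring

end NormedRing

end IsPrimitiveOn

end Calculus

noncomputable section

namespace LongRange

open MeasureTheory Set

section Evolution

variable {V : Type*} [Fintype V] [DecidableEq V] {d : V → ℕ} {H : ℝ → Op d} {T : ℝ}

theorem dysonTerm_zero (H : ℝ → Op d) (t : ℝ) : dysonTerm H 0 t = 1 := rfl

theorem dysonTerm_succ (H : ℝ → Op d) (n : ℕ) (t : ℝ) :
    dysonTerm H (n + 1) t = (-Complex.I) • ∫ s in (0 : ℝ)..t, H s * dysonTerm H n s := rfl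

theorem continuousOn_dysonTerm (hT : 0 ≤ T) (hH : IntervalIntegrable H volume 0 T) (n : ℕ) :
    ContinuousOn (dysonTerm H n) (Icc 0 T) := by
  induction n with
  | zero => exact continuousOn_const
  | succ n ih =>
    rw [← uIcc_of_le hT] at ih
    have h1 := (IsPrimitiveOn.of_integral (hH.mul_continuousOn ih) 0).continuousOn hT
    simp only [zero_add] at h1
    exact h1.const_smul (-Complex.I)

theorem isPrimitiveOn_norm_pow (hT : 0 ≤ T) (hH : IntervalIntegrable H volume 0 T) (n : ℕ) :
    IsPrimitiveOn (fun t => (∫ s in (0 : ℝ)..t, ‖H s‖) ^ (n + 1))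
      (fun t => (n + 1) * (‖H t‖ * (∫ s in (0 : ℝ)..t, ‖H s‖) ^ n)) T := by
  have h0 := IsPrimitiveOn.of_integral hH.norm 0
  simp only [zero_add] at h0
  induction n with
  | zero => simpa using h0
  | succ n ih =>
    have h1 := ih.mul h0 hT
    simp only [← pow_succ] at h1
    refine h1.congr_right hT fun t _ => ?_
    push_cast
    ring

theorem norm_one_le : ‖(1 : Op d)‖ ≤ 1 := by
  cases subsingleton_or_nontrivial (Op d)
  · rw [Subsingleton.elim (1 : Op d) 0, norm_zero]; exact zero_le_one
  · exact CStarRing.norm_one.le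

theorem norm_dysonTerm_le (hH : IntervalIntegrable H volume 0 T) (n : ℕ) :
    ∀ t ∈ Icc 0 T, ‖dysonTerm H n t‖ ≤ (∫ s in (0 : ℝ)..t, ‖H s‖) ^ n / n.factorial := by
  induction n with
  | zero => intro t _; simpa [dysonTerm_zero] using norm_one_le
  | succ n ih =>
    intro t ht
    have hHt : IntervalIntegrable H volume 0 t :=
      ((IsPrimitiveOn.of_integral hH 0).mono ht).intervalIntegrable
    have hp := isPrimitiveOn_norm_pow ht.1 hHt n
    have hint : IntervalIntegrable (fun s => ‖H s‖ * ((∫ r in (0 : ℝ)..s, ‖H r‖) ^ n /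
        n.factorial)) volume 0 t := by
      refine (hp.intervalIntegrable.const_mul (((n + 1).factorial : ℝ)⁻¹)).congr fun s _ => ?_
      rw [Nat.factorial_succ]
      push_cast
      field_simp
    have hc := continuousOn_dysonTerm ht.1 hHt n
    rw [← uIcc_of_le ht.1] at hc
    have hn1 : ‖(-Complex.I)‖ = 1 := by simp
    rw [dysonTerm_succ, norm_smul, hn1, one_mul]
    calc ‖∫ s in (0 : ℝ)..t, H s * dysonTerm H n s‖
        ≤ ∫ s in (0 : ℝ)..t, ‖H s * dysonTerm H n s‖ :=
          intervalIntegral.norm_integral_le_integral_norm ht.1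
      _ ≤ ∫ s in (0 : ℝ)..t, ‖H s‖ * ((∫ r in (0 : ℝ)..s, ‖H r‖) ^ n / n.factorial) := by
          refine intervalIntegral.integral_mono_on ht.1 (hHt.mul_continuousOn hc).norm hint
            fun s hs => (norm_mul_le _ _).trans ?_
          gcongr
          exact ih s ⟨hs.1, hs.2.trans ht.2⟩
      _ = ((n + 1).factorial : ℝ)⁻¹ * ∫ s in (0 : ℝ)..t,
            (n + 1) * (‖H s‖ * (∫ r in (0 : ℝ)..s, ‖H r‖) ^ n) := by
          rw [← intervalIntegral.integral_const_mul]
          refine intervalIntegral.integral_congr fun s _ => ?_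
          rw [Nat.factorial_succ]
          push_cast
          field_simp
      _ = (∫ s in (0 : ℝ)..t, ‖H s‖) ^ (n + 1) / (n + 1).factorial := by
          have := hp.eq_integral t ⟨ht.1, le_rfl⟩
          simp only [intervalIntegral.integral_same, ne_eq, not_false_eq_true,
            zero_pow, zero_add, add_eq_zero, one_ne_zero, and_false] at this
          rw [this]
          ring

theorem summable_norm_dysonTerm (hH : IntervalIntegrable H volume 0 T) {t : ℝ}
    (ht : t ∈ Icc 0 T) : Summable fun n => ‖dysonTerm H n t‖ :=
  Summable.of_nonneg_of_le (fun _ => norm_nonneg _)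
    (fun n => norm_dysonTerm_le hH n t ht) (Real.summable_pow_div_factorial _)

theorem timeEvolution_zero (H : ℝ → Op d) : timeEvolution H 0 = 1 := by
  rw [timeEvolution, tsum_eq_single 0, dysonTerm_zero]
  intro n hn
  obtain ⟨k, rfl⟩ := Nat.exists_eq_succ_of_ne_zero hn
  rw [Nat.succ_eq_add_one, dysonTerm_succ, intervalIntegral.integral_same, smul_zero]

theorem norm_dysonTerm_le_const (hH : IntervalIntegrable H volume 0 T) (n : ℕ) {t : ℝ}
    (ht : t ∈ Icc 0 T) :
    ‖dysonTerm H n t‖ ≤ (∫ s in (0 : ℝ)..T, ‖H s‖) ^ n / n.factorial := by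
  refine (norm_dysonTerm_le hH n t ht).trans ?_
  have h0 : 0 ≤ ∫ s in (0 : ℝ)..t, ‖H s‖ :=
    intervalIntegral.integral_nonneg ht.1 fun _ _ => norm_nonneg _
  have h1 : ∫ s in (0 : ℝ)..t, ‖H s‖ ≤ ∫ s in (0 : ℝ)..T, ‖H s‖ :=
    intervalIntegral.integral_mono_interval le_rfl ht.1 ht.2
      (Filter.Eventually.of_forall fun _ => norm_nonneg _) hH.norm
  exact div_le_div_of_nonneg_right (pow_le_pow_left₀ h0 h1 n) (Nat.cast_nonneg _)

theorem hasSum_dysonTerm (hH : IntervalIntegrable H volume 0 T) {t : ℝ} (ht : t ∈ Icc 0 T) :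
    HasSum (fun n => dysonTerm H n t) (timeEvolution H t) :=
  (summable_norm_dysonTerm hH ht).of_norm.hasSum

theorem continuousOn_timeEvolution (hT : 0 ≤ T) (hH : IntervalIntegrable H volume 0 T) :
    ContinuousOn (timeEvolution H) (Icc 0 T) :=
  continuousOn_tsum (fun n => continuousOn_dysonTerm hT hH n)
    (Real.summable_pow_div_factorial (∫ s in (0 : ℝ)..T, ‖H s‖))
    fun n _ ht => norm_dysonTerm_le_const hH n ht

theorem hasSum_integral_mul_dysonTerm (hT : 0 ≤ T) (hH : IntervalIntegrable H volume 0 T) :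
    HasSum (fun n => ∫ s in (0 : ℝ)..T, H s * dysonTerm H n s)
      (∫ s in (0 : ℝ)..T, H s * timeEvolution H s) := by
  have hsub : ∀ s ∈ uIoc 0 T, s ∈ Icc 0 T := by
    rw [uIoc_of_le hT]
    exact fun s hs => ⟨hs.1.le, hs.2⟩
  refine intervalIntegral.hasSum_integral_of_dominated_convergence
    (fun n s => ‖H s‖ * ((∫ r in (0 : ℝ)..T, ‖H r‖) ^ n / n.factorial)) (fun n => ?_)
    (fun n => Filter.Eventually.of_forall fun s hs => ?_)
    (Filter.Eventually.of_forall fun s _ =>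
      (Real.summable_pow_div_factorial _).mul_left _) ?_
    (Filter.Eventually.of_forall fun s hs => (hasSum_dysonTerm hH (hsub s hs)).mul_left _)
  · have hc := continuousOn_dysonTerm hT hH n
    rw [← uIcc_of_le hT] at hc
    exact (hH.mul_continuousOn hc).def'.aestronglyMeasurable
  · exact (norm_mul_le _ _).trans
      (mul_le_mul_of_nonneg_left (norm_dysonTerm_le_const hH n (hsub s hs)) (norm_nonneg _))
  · simp only [tsum_mul_left]
    exact hH.norm.mul_const _

/-- The time evolution operator solves the Schrödinger equation `U' = -i H U`. -/
theorem isPrimitiveOn_timeEvolution (hT : 0 ≤ T) (hH : IntervalIntegrable H volume 0 T) :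
    IsPrimitiveOn (timeEvolution H) (fun t => (-Complex.I) • (H t * timeEvolution H t)) T := by
  have hcont := continuousOn_timeEvolution hT hH
  rw [← uIcc_of_le hT] at hcont
  have hint := hH.mul_continuousOn hcont
  refine ⟨⟨hint.1.smul (-Complex.I), hint.2.smul (-Complex.I)⟩, fun t ht => ?_⟩
  have hHt : IntervalIntegrable H volume 0 t :=
    ((IsPrimitiveOn.of_integral hH 0).mono ht).intervalIntegrable
  have h2 : HasSum (fun n => dysonTerm H (n + 1) t)
      ((-Complex.I) • ∫ s in (0 : ℝ)..t, H s * timeEvolution H s) := by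
    simp only [dysonTerm_succ]
    exact (hasSum_integral_mul_dysonTerm ht.1 hHt).const_smul (-Complex.I)
  have h3 := (hasSum_nat_add_iff (f := fun n => dysonTerm H n t) 1).1 h2
  rw [Finset.sum_range_one, dysonTerm_zero] at h3
  rw [timeEvolution_zero, (hasSum_dysonTerm hH ht).unique h3, intervalIntegral.integral_smul,
    add_comm]

theorem isPrimitiveOn_star_timeEvolution (hT : 0 ≤ T) (hH : IntervalIntegrable H volume 0 T)
    (hsa : ∀ t ∈ Icc 0 T, IsSelfAdjoint (H t)) :
    IsPrimitiveOn (fun t => star (timeEvolution H t))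
      (fun t => Complex.I • (star (timeEvolution H t) * H t)) T := by
  refine ((isPrimitiveOn_timeEvolution hT hH).map
    (starL' ℝ : Op d ≃L[ℝ] Op d).toContinuousLinearMap).congr_right hT fun t ht => ?_
  simp [(hsa t ht).star_eq]

theorem timeEvolution_mem_unitary (hT : 0 ≤ T) (hH : IntervalIntegrable H volume 0 T)
    (hsa : ∀ t ∈ Icc 0 T, IsSelfAdjoint (H t)) {t : ℝ} (ht : t ∈ Icc 0 T) :
    timeEvolution H t ∈ unitary (Op d) := by
  have h := ((isPrimitiveOn_star_timeEvolution hT hH hsa).mul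
    (isPrimitiveOn_timeEvolution hT hH) hT).eq_zero_apply (fun s _ => by
      simp [mul_assoc]) ht
  rw [timeEvolution_zero, star_one, one_mul] at h
  exact ⟨h, mul_eq_one_comm.1 h⟩

/-- The evolution `W(t) = U(t) B U(t)†` satisfies `W' = -i [H, W]`. -/
theorem isPrimitiveOn_conj_timeEvolution (hT : 0 ≤ T) (hH : IntervalIntegrable H volume 0 T)
    (hsa : ∀ t ∈ Icc 0 T, IsSelfAdjoint (H t)) (B : Op d) :
    IsPrimitiveOn (fun t => timeEvolution H t * B * star (timeEvolution H t))
      (fun t => (-Complex.I) • (H t * (timeEvolution H t * B * star (timeEvolution H t)) -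
        timeEvolution H t * B * star (timeEvolution H t) * H t)) T := by
  refine (((isPrimitiveOn_timeEvolution hT hH).mul (IsPrimitiveOn.const B T) hT).mul
    (isPrimitiveOn_star_timeEvolution hT hH hsa) hT).congr_right hT fun t _ => ?_
  simp only [mul_zero, add_zero, smul_mul_assoc, mul_smul_comm, smul_sub, neg_smul, mul_assoc,
    neg_mul]
  abel

theorem heisenberg_commutator_norm_eq (hT : 0 ≤ T) (hH : IntervalIntegrable H volume 0 T)
    (hsa : ∀ t ∈ Icc 0 T, IsSelfAdjoint (H t)) (A B : Op d) {t : ℝ} (ht : t ∈ Icc 0 T) :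
    ‖heisenberg H A t * B - B * heisenberg H A t‖ =
      ‖A * (timeEvolution H t * B * star (timeEvolution H t)) -
        timeEvolution H t * B * star (timeEvolution H t) * A‖ := by
  have hU := timeEvolution_mem_unitary hT hH hsa ht
  have hU' : star (timeEvolution H t) ∈ unitary (Op d) := Unitary.star_mem hU
  have h1 : star (timeEvolution H t) * timeEvolution H t = 1 := hU.1
  rw [heisenberg]
  set U := timeEvolution H t
  have : star U * A * U * B - B * (star U * A * U) =
      star U * (A * (U * B * star U) - U * B * star U * A) * U := by
    have e1 : star U * (A * (U * B * star U)) * U = star U * A * U * B * (star U * U) := by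
      noncomm_ring
    have e2 : star U * (U * B * star U * A) * U = (star U * U) * B * (star U * A * U) := by
      noncomm_ring
    rw [mul_sub, sub_mul, e1, e2, h1, mul_one, one_mul]
  rw [this, CStarRing.norm_mul_mem_unitary _ hU, CStarRing.norm_mem_unitary_mul _ hU']

/-- A solution of `D' = -i [K, D] + S` grows at most by the integral of `‖S‖`. -/
theorem norm_le_of_commutator_equation {K D S : ℝ → Op d} (hT : 0 ≤ T)
    (hK : IntervalIntegrable K volume 0 T) (hsa : ∀ t ∈ Icc 0 T, IsSelfAdjoint (K t))
    (hD : IsPrimitiveOn D (fun t => (-Complex.I) • (K t * D t - D t * K t) + S t) T)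
    {t : ℝ} (ht : t ∈ Icc 0 T) :
    ‖D t‖ ≤ ‖D 0‖ + ∫ s in (0 : ℝ)..t, ‖S s‖ := by
  set U := timeEvolution K
  have hU : ∀ s ∈ Icc 0 T, U s ∈ unitary (Op d) := fun s hs =>
    timeEvolution_mem_unitary hT hK hsa hs
  have hnorm : ∀ s ∈ Icc 0 T, ∀ A : Op d, ‖star (U s) * A * U s‖ = ‖A‖ := fun s hs A => by
    rw [CStarRing.norm_mul_mem_unitary _ (hU s hs),
      CStarRing.norm_mem_unitary_mul _ (Unitary.star_mem (hU s hs))]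
  have hZ : IsPrimitiveOn (fun s => star (U s) * D s * U s)
      (fun s => star (U s) * S s * U s) T := by
    refine (((isPrimitiveOn_star_timeEvolution hT hK hsa).mul hD hT).mul
      (isPrimitiveOn_timeEvolution hT hK) hT).congr_right hT fun s _ => ?_
    simp only [mul_add, add_mul, mul_sub, sub_mul, smul_mul_assoc, mul_smul_comm, smul_sub,
      neg_smul, mul_assoc, neg_mul, mul_neg]
    abel
  have h1 := hZ.norm_le ht
  rw [hnorm t ht, hnorm 0 ⟨le_rfl, hT⟩] at h1
  refine h1.trans_eq ?_
  congr 1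
  refine intervalIntegral.integral_congr fun s hs => ?_
  rw [uIcc_of_le ht.1] at hs
  exact hnorm s ⟨hs.1, hs.2.trans ht.2⟩ _

end Evolution

end LongRange

end

noncomputable section

namespace LongRange

open scoped Matrix in
/-- A completely positive unital map in Kraus form is a contraction. -/
theorem norm_sum_conjTranspose_mul_mul_le {n ι : Type*} [Fintype n] [DecidableEq n] [Fintype ι]
    [DecidableEq ι] (K : ι → Matrix n n ℂ) (hK : ∑ i, (K i)ᴴ * K i = 1) (W : Matrix n n ℂ) :
    ‖∑ i, (K i)ᴴ * W * K i‖ ≤ ‖W‖ := by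
  let M : Matrix (n × ι) n ℂ := Matrix.of fun p s => K p.2 p.1 s
  have hM : ∀ A : Matrix n n ℂ,
      Mᴴ * (Matrix.blockDiagonal fun _ : ι => A) * M = ∑ i, (K i)ᴴ * A * K i := by
    intro A
    have h1 : (Matrix.blockDiagonal fun _ : ι => A) * M =
        Matrix.of fun p s => (A * K p.2) p.1 s := by
      ext p s
      simp [Matrix.mul_apply, Fintype.sum_prod_type, Matrix.blockDiagonal_apply, M]
    rw [Matrix.mul_assoc, h1]
    ext s s'
    simp only [Matrix.mul_apply, Fintype.sum_prod_type, Matrix.conjTranspose_apply,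
      Matrix.sum_apply, M, Matrix.mul_assoc, Matrix.of_apply]
    rw [Finset.sum_comm]
  have hnorm : ‖M‖ * ‖M‖ ≤ 1 := by
    rw [← Matrix.l2_opNorm_conjTranspose_mul_self]
    have h1 := hM 1
    rw [show (Matrix.blockDiagonal fun _ : ι => (1 : Matrix n n ℂ)) = 1 from
      Matrix.blockDiagonal_one, Matrix.mul_one] at h1
    simp only [Matrix.mul_one] at h1
    rw [h1, hK]
    cases subsingleton_or_nontrivial (Matrix n n ℂ)
    · rw [Subsingleton.elim (1 : Matrix n n ℂ) 0, norm_zero]; exact zero_le_one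
    · exact CStarRing.norm_one.le
  let φ : Matrix n n ℂ →⋆ₐ[ℂ] Matrix (n × ι) (n × ι) ℂ :=
    { toFun := fun A => Matrix.blockDiagonal fun _ => A
      map_one' := Matrix.blockDiagonal_one
      map_mul' := fun A B => Matrix.blockDiagonal_mul _ _
      map_zero' := Matrix.blockDiagonal_zero
      map_add' := fun A B => Matrix.blockDiagonal_add _ _
      commutes' := fun c => by
        simp only [Algebra.algebraMap_eq_smul_one]
        rw [← Matrix.blockDiagonal_one, ← Matrix.blockDiagonal_smul]
        rfl
      map_star' := fun A => (Matrix.blockDiagonal_conjTranspose _).symm }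
  have hφ : ‖Matrix.blockDiagonal fun _ : ι => W‖ ≤ ‖W‖ :=
    NonUnitalStarAlgHom.norm_apply_le (φ : Matrix n n ℂ →⋆ₙₐ[ℂ] Matrix (n × ι) (n × ι) ℂ) W
  rw [← hM W]
  calc ‖Mᴴ * (Matrix.blockDiagonal fun _ : ι => W) * M‖
      ≤ ‖Mᴴ‖ * ‖Matrix.blockDiagonal fun _ : ι => W‖ * ‖M‖ :=
        (Matrix.l2_opNorm_mul _ _).trans (by gcongr; exact Matrix.l2_opNorm_mul _ _)
    _ ≤ ‖M‖ * ‖W‖ * ‖M‖ := by rw [Matrix.l2_opNorm_conjTranspose]; gcongr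
    _ = ‖M‖ * ‖M‖ * ‖W‖ := by ring
    _ ≤ ‖W‖ := mul_le_of_le_one_left (norm_nonneg _) hnorm

section SiteAlgebra

theorem eq_update_iff {V : Type*} [DecidableEq V] {d : V → ℕ} (x : V) (a b : Fin (d x))
    (r s : Config d) :
    (r x = a ∧ s = Function.update r x b) ↔ (s x = b ∧ r = Function.update s x a) := by
  constructor <;> rintro ⟨rfl, rfl⟩ <;> simp

theorem natCast_dim_ne_zero {V : Type*} {d : V → ℕ} [Nonempty (Config d)] (x : V) :
    (d x : ℂ) ≠ 0 := by
  obtain ⟨s⟩ := ‹Nonempty (Config d)›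
  have := (s x).pos
  exact_mod_cast this.ne'

variable {V : Type*} [Fintype V] [DecidableEq V] {d : V → ℕ}

/-- The matrix unit `|a⟩⟨b|` of the spin at the site `x`, tensored with the identity on the other
sites. -/
def siteUnit (x : V) (a b : Fin (d x)) : Op d :=
  fun s s' => if s x = a ∧ s' = Function.update s x b then 1 else 0

theorem siteUnit_mul_apply (x : V) (a b : Fin (d x)) (W : Op d) (s s' : Config d) :
    (siteUnit x a b * W) s s' = if s x = a then W (Function.update s x b) s' else 0 := by
  rw [Matrix.mul_apply]
  by_cases h : s x = a <;> simp [siteUnit, h]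

theorem mul_siteUnit_apply (x : V) (a b : Fin (d x)) (W : Op d) (s s' : Config d) :
    (W * siteUnit x a b) s s' = if s' x = b then W s (Function.update s' x a) else 0 := by
  rw [Matrix.mul_apply]
  simp only [siteUnit, eq_update_iff x a b]
  by_cases h : s' x = b <;> simp [h]

theorem siteUnit_mul_siteUnit (x : V) (a b c e : Fin (d x)) :
    (siteUnit x a b * siteUnit x c e : Op d) = if b = c then siteUnit x a e else 0 := by
  ext s s'
  rw [siteUnit_mul_apply]
  by_cases h : s x = a <;> by_cases h' : b = c <;> simp [siteUnit, h, h']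

theorem star_siteUnit (x : V) (a b : Fin (d x)) : star (siteUnit x a b : Op d) = siteUnit x b a := by
  ext s s'
  rw [Matrix.star_apply, siteUnit, siteUnit]
  simp only [eq_update_iff x a b]
  split_ifs <;> simp

theorem sum_siteUnit_self (x : V) : ∑ a, (siteUnit x a a : Op d) = 1 := by
  ext s s'
  rw [Matrix.sum_apply, Finset.sum_eq_single (s x)]
  · simp [siteUnit, Matrix.one_apply, eq_comm]
  · intro b _ hb
    simp [siteUnit, hb.symm]
  · simp

theorem siteUnit_commute {x y : V} (hxy : x ≠ y) (a b : Fin (d x)) (c e : Fin (d y)) :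
    Commute (siteUnit x a b : Op d) (siteUnit y c e) := by
  ext s s'
  rw [siteUnit_mul_apply, siteUnit_mul_apply]
  simp only [siteUnit, Function.update_of_ne hxy, Function.update_of_ne hxy.symm]
  rw [Function.update_comm hxy]
  by_cases h : s x = a <;> by_cases h' : s y = c <;> simp [h, h']

/-- `A` acts trivially on the site `x`: it commutes with all operators supported on `x`. -/
def TrivialAt (x : V) (A : Op d) : Prop := ∀ a b, Commute (siteUnit x a b) A

theorem SupportedOn.trivialAt {X : Finset V} {A : Op d} (hA : SupportedOn X A) {x : V}
    (hx : x ∉ X) : TrivialAt x A := by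
  obtain ⟨m, hm⟩ := hA
  intro a b
  ext s s'
  rw [siteUnit_mul_apply, mul_siteUnit_apply, hm, hm]
  have hX : ∀ (r : Config d) (c : Fin (d x)),
      (fun i : X => Function.update r x c i) = fun i : X => r i := fun r c => by
    funext i
    exact Function.update_of_ne (fun h => hx (by rw [← h]; exact i.2)) _ _
  rw [hX, hX]
  have h1 : (∀ i, i ∉ X → Function.update s x b i = s' i) ↔
      (s' x = b ∧ ∀ i, i ∉ X → i ≠ x → s i = s' i) := by
    refine ⟨fun h => ⟨by simpa using (h x hx).symm, fun i hi hix => ?_⟩, fun h i hi => ?_⟩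
    · simpa [Function.update_of_ne hix] using h i hi
    · by_cases hix : i = x
      · subst hix; simp [h.1]
      · simpa [Function.update_of_ne hix] using h.2 i hi hix
  have h2 : (∀ i, i ∉ X → s i = Function.update s' x a i) ↔
      (s x = a ∧ ∀ i, i ∉ X → i ≠ x → s i = s' i) := by
    refine ⟨fun h => ⟨by simpa using (h x hx), fun i hi hix => ?_⟩, fun h i hi => ?_⟩
    · simpa [Function.update_of_ne hix] using h i hi
    · by_cases hix : i = x
      · subst hix; simp [h.1]
      · simpa [Function.update_of_ne hix] using h.2 i hi hix
  simp only [h1, h2]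
  by_cases hs : s x = a <;> by_cases hs' : s' x = b <;> simp [hs, hs']

namespace TrivialAt

variable {x : V} {A B : Op d}

theorem mul (hA : TrivialAt x A) (hB : TrivialAt x B) : TrivialAt x (A * B) :=
  fun a b => (hA a b).mul_right (hB a b)

theorem smul (hA : TrivialAt x A) (c : ℂ) : TrivialAt x (c • A) :=
  fun a b => (hA a b).smul_right c

theorem sum {ι : Type*} {S : Finset ι} {f : ι → Op d} (h : ∀ i ∈ S, TrivialAt x (f i)) :
    TrivialAt x (∑ i ∈ S, f i) :=
  fun a b => Commute.sum_right _ _ _ fun i hi => h i hi a b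

theorem siteUnit {y : V} (hxy : x ≠ y) (a b : Fin (d y)) : TrivialAt x (siteUnit y a b : Op d) :=
  fun _ _ => siteUnit_commute hxy _ _ _ _

end TrivialAt

/-- The coefficient of `|a⟩⟨b|` at the site `x` in the operator `A`. -/
def siteCoeff (x : V) (a b : Fin (d x)) (A : Op d) : Op d :=
  ∑ c, siteUnit x c a * A * siteUnit x b c

theorem siteUnit_mul_siteCoeff (x : V) (a b e f : Fin (d x)) (A : Op d) :
    siteUnit x e f * siteCoeff x a b A = siteUnit x e a * A * siteUnit x b f := by
  rw [siteCoeff, Finset.mul_sum, Finset.sum_eq_single f]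
  · rw [← mul_assoc, ← mul_assoc, siteUnit_mul_siteUnit, if_pos rfl]
  · intro c _ hc
    rw [← mul_assoc, ← mul_assoc, siteUnit_mul_siteUnit, if_neg hc.symm, zero_mul, zero_mul]
  · simp

theorem siteCoeff_mul_siteUnit (x : V) (a b e f : Fin (d x)) (A : Op d) :
    siteCoeff x a b A * siteUnit x e f = siteUnit x e a * A * siteUnit x b f := by
  rw [siteCoeff, Finset.sum_mul, Finset.sum_eq_single e]
  · rw [mul_assoc, siteUnit_mul_siteUnit, if_pos rfl]
  · intro c _ hc
    rw [mul_assoc, siteUnit_mul_siteUnit, if_neg hc, mul_zero]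
  · simp

theorem trivialAt_siteCoeff_self (x : V) (a b : Fin (d x)) (A : Op d) :
    TrivialAt x (siteCoeff x a b A) := fun e f => by
  rw [commute_iff_eq, siteUnit_mul_siteCoeff, siteCoeff_mul_siteUnit]

theorem TrivialAt.siteCoeff {x y : V} {A : Op d} (hA : TrivialAt y A) (hxy : y ≠ x)
    (a b : Fin (d x)) : TrivialAt y (siteCoeff x a b A) :=
  TrivialAt.sum fun _ _ => ((TrivialAt.siteUnit hxy _ _).mul hA).mul (TrivialAt.siteUnit hxy _ _)

theorem eq_sum_siteUnit_mul_siteCoeff (x : V) (A : Op d) :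
    A = ∑ a, ∑ b, siteUnit x a b * siteCoeff x a b A := by
  simp only [siteUnit_mul_siteCoeff]
  simp only [← Finset.mul_sum]
  rw [sum_siteUnit_self, ← Finset.sum_mul]
  simp only [mul_one]
  rw [← Finset.sum_mul, sum_siteUnit_self, one_mul]

/-- An operator which acts trivially on all sites is a scalar. -/
theorem eq_smul_one_of_forall_trivialAt {A : Op d} (hA : ∀ x, TrivialAt x A) :
    ∃ c : ℂ, A = c • 1 := by
  rcases isEmpty_or_nonempty (Config d) with hE | ⟨⟨s₀⟩⟩
  · exact ⟨0, Subsingleton.elim _ _⟩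
  have hoff : ∀ s s' : Config d, s ≠ s' → A s s' = 0 := by
    intro s s' hs
    obtain ⟨x, hx⟩ := Function.ne_iff.1 hs
    have h := congr_fun₂ (hA x (s x) (s x)).eq s s'
    rw [siteUnit_mul_apply, mul_siteUnit_apply, if_pos rfl, if_neg hx.symm,
      Function.update_eq_self] at h
    exact h
  have hupd : ∀ (s : Config d) (x : V) (b : Fin (d x)),
      A (Function.update s x b) (Function.update s x b) = A s s := by
    intro s x b
    have h := congr_fun₂ (hA x (s x) b).eq s (Function.update s x b)
    rw [siteUnit_mul_apply, mul_siteUnit_apply, if_pos rfl, if_pos (Function.update_self ..),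
      Function.update_idem, Function.update_eq_self] at h
    exact h
  have hdiag : ∀ (s : Config d) (S : Finset V), A (S.piecewise s s₀) (S.piecewise s s₀) = A s₀ s₀ := by
    intro s S
    induction S using Finset.induction_on with
    | empty => simp
    | insert x S hx ih => rw [Finset.piecewise_insert, hupd, ih]
  refine ⟨A s₀ s₀, ?_⟩
  ext s s'
  by_cases h : s = s'
  · subst h
    rw [Matrix.smul_apply, Matrix.one_apply_eq, smul_eq_mul, mul_one]
    simpa using hdiag s Finset.univ
  · rw [hoff s s' h, Matrix.smul_apply, Matrix.one_apply_ne h, smul_zero]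

/-- Operators acting nontrivially on disjoint sets of sites commute. -/
theorem commute_of_trivialAt (X : Finset V) {W : Op d} (hW : ∀ x ∈ X, TrivialAt x W) :
    ∀ A : Op d, (∀ x, x ∉ X → TrivialAt x A) → Commute A W := by
  induction X using Finset.induction_on with
  | empty =>
    intro A hA
    obtain ⟨c, rfl⟩ := eq_smul_one_of_forall_trivialAt fun x => hA x (Finset.notMem_empty x)
    exact (Commute.one_left W).smul_left c
  | insert x X hx ih =>
    intro A hA
    rw [eq_sum_siteUnit_mul_siteCoeff x A]
    refine Commute.sum_left _ _ _ fun a _ => Commute.sum_left _ _ _ fun b _ =>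
      Commute.mul_left (hW x (Finset.mem_insert_self x X) a b)
        (ih (fun y hy => hW y (Finset.mem_insert_of_mem hy)) _ fun y hy => ?_)
    by_cases hyx : y = x
    · subst hyx; exact trivialAt_siteCoeff_self _ _ _ _
    · exact (hA y (by simp [hyx, hy])).siteCoeff hyx a b

theorem SupportedOn.commute {X : Finset V} {A W : Op d} (hA : SupportedOn X A)
    (hW : ∀ x ∈ X, TrivialAt x W) : Commute A W :=
  commute_of_trivialAt X hW A fun _ hx => hA.trivialAt hx

/-- The normalized partial trace over the site `x`, tensored with the identity on `x`. -/
def siteExp (x : V) : Op d →ₗ[ℂ] Op d where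
  toFun W := (d x : ℂ)⁻¹ • ∑ a, ∑ b, siteUnit x a b * W * siteUnit x b a
  map_add' A B := by simp only [mul_add, add_mul, Finset.sum_add_distrib, smul_add]
  map_smul' c A := by
    simp only [mul_smul_comm, smul_mul_assoc, ← Finset.smul_sum, RingHom.id_apply]
    rw [smul_comm]

theorem siteExp_def (x : V) (W : Op d) :
    siteExp x W = (d x : ℂ)⁻¹ • ∑ a, ∑ b, siteUnit x a b * W * siteUnit x b a := rfl

theorem siteExp_apply (x : V) (W : Op d) :
    siteExp x W = (d x : ℂ)⁻¹ • ∑ b, siteCoeff x b b W := by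
  rw [siteExp_def, Finset.sum_comm]
  rfl

theorem trivialAt_siteExp_self (x : V) (W : Op d) : TrivialAt x (siteExp x W) := by
  rw [siteExp_apply]
  exact (TrivialAt.sum fun b _ => trivialAt_siteCoeff_self x b b W).smul _

theorem TrivialAt.siteExp {x y : V} {W : Op d} (hW : TrivialAt y W) (hxy : y ≠ x) :
    TrivialAt y (siteExp x W) := by
  rw [siteExp_apply]
  exact (TrivialAt.sum fun b _ => hW.siteCoeff hxy b b).smul _

theorem TrivialAt.siteExp_mul {x : V} {A : Op d} (hA : TrivialAt x A) (W : Op d) :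
    LongRange.siteExp x (A * W) = A * LongRange.siteExp x W := by
  rw [siteExp_def, siteExp_def, mul_smul_comm]
  simp only [Finset.mul_sum]
  refine congrArg _ ?_
  refine Finset.sum_congr rfl fun a _ => Finset.sum_congr rfl fun b _ => ?_
  rw [← mul_assoc, ← mul_assoc, ← mul_assoc, (hA a b).eq]

theorem TrivialAt.siteExp_mul' {x : V} {A : Op d} (hA : TrivialAt x A) (W : Op d) :
    LongRange.siteExp x (W * A) = LongRange.siteExp x W * A := by
  rw [siteExp_def, siteExp_def, smul_mul_assoc]
  simp only [Finset.sum_mul]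
  refine congrArg _ ?_
  refine Finset.sum_congr rfl fun a _ => Finset.sum_congr rfl fun b _ => ?_
  simp only [mul_assoc]
  rw [(hA b a).eq]

theorem siteExp_siteUnit_mul (x : V) (c e : Fin (d x)) (W : Op d) :
    siteExp x (siteUnit x c e * W) = siteExp x (W * siteUnit x c e) := by
  rw [siteExp_def, siteExp_def]
  refine congrArg _ ?_
  refine Finset.sum_congr rfl fun a _ => ?_
  rw [Finset.sum_eq_single c, Finset.sum_eq_single e]
  · simp only [mul_assoc, siteUnit_mul_siteUnit, if_true]
    simp only [← mul_assoc, siteUnit_mul_siteUnit, if_true]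
  · intro b _ hb
    simp [mul_assoc, siteUnit_mul_siteUnit, hb.symm]
  · simp
  · intro b _ hb
    simp [← mul_assoc, siteUnit_mul_siteUnit, hb]
  · simp

/-- The partial trace is cyclic with respect to operators on the site traced over. -/
theorem SupportedOn.siteExp_mul_comm {x : V} {A : Op d} (hA : SupportedOn {x} A) (W : Op d) :
    siteExp x (A * W) = siteExp x (W * A) := by
  have hscal : ∀ a b, ∀ y, TrivialAt y (siteCoeff x a b A) := by
    intro a b y
    by_cases hyx : y = x
    · subst hyx; exact trivialAt_siteCoeff_self _ _ _ _
    · exact (hA.trivialAt (by simpa using hyx)).siteCoeff hyx a b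
  rw [eq_sum_siteUnit_mul_siteCoeff x A]
  simp only [Finset.sum_mul, Finset.mul_sum, map_sum]
  refine Finset.sum_congr rfl fun a _ => Finset.sum_congr rfl fun b _ => ?_
  obtain ⟨c, hc⟩ := eq_smul_one_of_forall_trivialAt (hscal a b)
  rw [hc]
  simp only [mul_smul_comm, smul_mul_assoc, mul_one, map_smul, siteExp_siteUnit_mul]

theorem sum_siteUnit_mul_siteUnit (x : V) :
    ∑ a, ∑ b, (siteUnit x a b * siteUnit x b a : Op d) = (d x : ℂ) • 1 := by
  simp only [siteUnit_mul_siteUnit, if_true, Finset.sum_const, Finset.card_univ, Fintype.card_fin,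
    ← Finset.smul_sum, sum_siteUnit_self, Nat.cast_smul_eq_nsmul]

theorem TrivialAt.siteExp_eq {x : V} {W : Op d} (hW : TrivialAt x W) :
    LongRange.siteExp x W = W := by
  rcases isEmpty_or_nonempty (Config d) with hE | hE
  · exact Subsingleton.elim _ _
  rw [← mul_one W, hW.siteExp_mul]
  congr 1
  rw [siteExp_def]
  simp only [mul_one]
  rw [sum_siteUnit_mul_siteUnit, smul_smul, inv_mul_cancel₀ (natCast_dim_ne_zero x), one_smul]

theorem norm_siteExp_le (x : V) (W : Op d) : ‖siteExp x W‖ ≤ ‖W‖ := by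
  rcases isEmpty_or_nonempty (Config d) with hE | hE
  · rw [Subsingleton.elim (siteExp x W) W]
  have hd := natCast_dim_ne_zero (d := d) x
  set r : ℂ := ((Real.sqrt (d x : ℝ) : ℝ) : ℂ)⁻¹ with hr
  have hrr : star r * r = (d x : ℂ)⁻¹ := by
    rw [hr, ← Complex.ofReal_inv, Complex.star_def, Complex.conj_ofReal, ← Complex.ofReal_mul,
      ← mul_inv, Real.mul_self_sqrt (Nat.cast_nonneg _)]
    simp
  have hterm : ∀ (p : Fin (d x) × Fin (d x)) (A : Op d),
      (r • siteUnit x p.2 p.1 : Op d).conjTranspose * A * (r • siteUnit x p.2 p.1) =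
        (d x : ℂ)⁻¹ • (siteUnit x p.1 p.2 * A * siteUnit x p.2 p.1) := by
    intro p A
    rw [← Matrix.star_eq_conjTranspose, star_smul, star_siteUnit, ← hrr]
    simp only [smul_mul_assoc, mul_smul_comm, smul_smul]
    rw [mul_comm]
  have h := norm_sum_conjTranspose_mul_mul_le
    (fun p : Fin (d x) × Fin (d x) => (r • siteUnit x p.2 p.1 : Op d)) (by
      have h1 : ∀ p : Fin (d x) × Fin (d x), (r • siteUnit x p.2 p.1 : Op d).conjTranspose *
          (r • siteUnit x p.2 p.1) =
          (d x : ℂ)⁻¹ • (siteUnit x p.1 p.2 * siteUnit x p.2 p.1) := fun p => by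
        simpa using hterm p 1
      simp only [h1]
      rw [← Finset.smul_sum, Fintype.sum_prod_type, sum_siteUnit_mul_siteUnit, smul_smul,
        inv_mul_cancel₀ hd, one_smul]) W
  simp only [hterm] at h
  rw [← Finset.smul_sum, Fintype.sum_prod_type] at h
  exact h

/-- The part of an operator which acts nontrivially on the site `x`. -/
def siteDefect (x : V) : Op d →ₗ[ℂ] Op d := LinearMap.id - siteExp x

theorem siteDefect_apply (x : V) (W : Op d) : siteDefect x W = W - siteExp x W := rfl

theorem norm_siteDefect_le (x : V) (W : Op d) : ‖siteDefect x W‖ ≤ 2 * ‖W‖ := by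
  rw [siteDefect_apply, two_mul]
  exact (norm_sub_le _ _).trans (by gcongr; exact norm_siteExp_le x W)

theorem TrivialAt.siteDefect_eq_zero {x : V} {W : Op d} (hW : TrivialAt x W) :
    siteDefect x W = 0 := by
  rw [siteDefect_apply, hW.siteExp_eq, sub_self]

theorem TrivialAt.siteDefect_commutator {x : V} {A : Op d} (hA : TrivialAt x A) (W : Op d) :
    siteDefect x (A * W - W * A) = A * siteDefect x W - siteDefect x W * A := by
  simp only [siteDefect_apply, map_sub, hA.siteExp_mul, hA.siteExp_mul', mul_sub, sub_mul]

theorem SupportedOn.siteDefect_commutator {x : V} {A : Op d} (hA : SupportedOn {x} A) (W : Op d) :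
    siteDefect x (A * W - W * A) = A * siteDefect x W - siteDefect x W * A := by
  have h : A * siteExp x W = siteExp x W * A := hA.commute (by
    simpa using trivialAt_siteExp_self x W)
  simp only [siteDefect_apply, map_sub, hA.siteExp_mul_comm, mul_sub, sub_mul, h]
  abel

theorem exists_trivialAt_norm_sub_le (X : Finset V) (W : Op d) :
    ∃ W' : Op d, (∀ x ∈ X, TrivialAt x W') ∧ ‖W - W'‖ ≤ ∑ x ∈ X, ‖siteDefect x W‖ := by
  induction X using Finset.induction_on with
  | empty => exact ⟨W, by simp, by simp⟩
  | insert x X hx ih =>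
    obtain ⟨W', h1, h2⟩ := ih
    refine ⟨siteExp x W', fun y hy => ?_, ?_⟩
    · by_cases hyx : y = x
      · subst hyx; exact trivialAt_siteExp_self _ _
      · exact (h1 y ((Finset.mem_insert.1 hy).resolve_left hyx)).siteExp hyx
    · rw [Finset.sum_insert hx]
      calc ‖W - siteExp x W'‖ = ‖siteDefect x W + siteExp x (W - W')‖ := by
            rw [siteDefect_apply, map_sub]; congr 1; abel
        _ ≤ ‖siteDefect x W‖ + ‖siteExp x (W - W')‖ := norm_add_le _ _
        _ ≤ _ := by gcongr; exact (norm_siteExp_le _ _).trans h2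

theorem SupportedOn.norm_commutator_le {X : Finset V} {A : Op d} (hA : SupportedOn X A)
    (W : Op d) : ‖A * W - W * A‖ ≤ 2 * ‖A‖ * ∑ x ∈ X, ‖siteDefect x W‖ := by
  obtain ⟨W', h1, h2⟩ := exists_trivialAt_norm_sub_le X W
  have h3 : A * W' = W' * A := hA.commute h1
  have h4 : A * W - W * A = A * (W - W') - (W - W') * A := by
    rw [mul_sub, sub_mul, h3]; abel
  rw [h4]
  calc ‖A * (W - W') - (W - W') * A‖ ≤ ‖A‖ * ‖W - W'‖ + ‖W - W'‖ * ‖A‖ :=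
        (norm_sub_le _ _).trans (add_le_add (norm_mul_le _ _) (norm_mul_le _ _))
    _ = 2 * ‖A‖ * ‖W - W'‖ := by ring
    _ ≤ _ := by gcongr

end SiteAlgebra

end LongRange

end

noncomputable section

namespace LongRange

open Metric MeasureTheory Module

/-- Two distinct points of a discrete subgroup have at least a certain positive distance. -/
theorem exists_pos_forall_le_dist {E : Type*} [NormedAddCommGroup E] (L : Submodule ℤ E)
    [DiscreteTopology L] : ∃ ρ : ℝ, 0 < ρ ∧ ∀ x ∈ L, ∀ y ∈ L, x ≠ y → ρ ≤ dist x y := by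
  obtain ⟨ρ, hρ, h⟩ := exists_ball_inter_eq_singleton_of_mem_discrete (s := (L : Set E))
    (isDiscrete_iff_discreteTopology.2 ‹_›) L.zero_mem
  refine ⟨ρ, hρ, fun x hx y hy hxy => ?_⟩
  by_contra! hlt
  have h1 : x - y ∈ ball (0 : E) ρ ∩ L :=
    ⟨by rwa [mem_ball_zero_iff, ← dist_eq_norm], L.sub_mem hx hy⟩
  rw [h, Set.mem_singleton_iff, sub_eq_zero] at h1
  exact hxy h1

section Packing

variable {E : Type*} [NormedAddCommGroup E] [NormedSpace ℝ E] [FiniteDimensional ℝ E]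

theorem card_le_of_separated_of_subset_closedBall {s : Finset E} {ρ r : ℝ} {x : E} (hρ : 0 < ρ)
    (hr : ρ ≤ r) (hsep : ∀ y ∈ s, ∀ z ∈ s, y ≠ z → ρ ≤ dist y z)
    (hball : ∀ y ∈ s, dist y x ≤ r) : (s.card : ℝ) ≤ (3 * r / ρ) ^ finrank ℝ E := by
  borelize E
  let μ : Measure E := Measure.addHaar
  have hρ2 : 0 < ρ / 2 := half_pos hρ
  have hr2 : 0 < 3 * r / 2 := by linarith
  have hdisj : Set.Pairwise (s : Set E) (Function.onFun Disjoint fun c => ball c (ρ / 2)) := by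
    intro y hy z hz hyz
    refine ball_disjoint_ball ?_
    linarith [hsep y hy z hz hyz]
  have hsub : (⋃ c ∈ s, ball c (ρ / 2)) ⊆ ball x (3 * r / 2) := by
    refine Set.iUnion₂_subset fun y hy => ball_subset_ball' ?_
    linarith [hball y hy]
  have h1 : (s.card : ℝ≥0∞) * ENNReal.ofReal ((ρ / 2) ^ finrank ℝ E) * μ (ball 0 1) ≤
      ENNReal.ofReal ((3 * r / 2) ^ finrank ℝ E) * μ (ball 0 1) :=
    calc
      _ = μ (⋃ c ∈ s, ball c (ρ / 2)) := by
        rw [measure_biUnion_finset hdisj fun c _ => measurableSet_ball]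
        simp only [μ.addHaar_ball_of_pos _ hρ2]
        simp only [Finset.sum_const, nsmul_eq_mul, mul_assoc]
      _ ≤ μ (ball x (3 * r / 2)) := measure_mono hsub
      _ = _ := by simp only [μ.addHaar_ball_of_pos _ hr2]
  have h2 := (ENNReal.mul_le_mul_iff_left (measure_ball_pos μ _ zero_lt_one).ne'
    measure_ball_lt_top.ne).1 h1
  have h3 := ENNReal.toReal_le_of_le_ofReal (pow_nonneg hr2.le _) h2
  rw [ENNReal.toReal_mul, ENNReal.toReal_natCast, ENNReal.toReal_ofReal (by positivity),
    ← le_div_iff₀ (by positivity), ← div_pow] at h3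
  refine h3.trans_eq ?_
  congr 1
  field_simp

/-- Sums of inverse powers of distances over separated sets, by removing the farthest point. -/
theorem sum_dist_rpow_neg_le {ρ α : ℝ} (hρ : 0 < ρ) (hα₀ : 0 ≤ α) (hα : α < finrank ℝ E) (x : E)
    (n : ℕ) : ∀ s : Finset E, s.card = n → (∀ y ∈ s, ∀ z ∈ s, y ≠ z → ρ ≤ dist y z) →
      (∀ y ∈ s, ρ ≤ dist y x) →
      ∑ y ∈ s, dist y x ^ (-α) ≤ (ρ / 3) ^ (-α) / (1 - α / finrank ℝ E) *
        (n : ℝ) ^ (1 - α / finrank ℝ E) := by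
  classical
  have hD : (0 : ℝ) < finrank ℝ E := hα₀.trans_lt hα
  have hD' : finrank ℝ E ≠ 0 := by
    intro h; rw [h] at hD; simp at hD
  set β : ℝ := 1 - α / finrank ℝ E with hβ
  have hβ0 : 0 < β := by rw [hβ, sub_pos, div_lt_one hD]; exact hα
  have hβ1 : β ≤ 1 := by rw [hβ]; linarith [div_nonneg hα₀ hD.le]
  have hc : 0 < (ρ / 3) ^ (-α) := Real.rpow_pos_of_pos (by linarith) _
  induction n with
  | zero =>
    intro s hs _ _
    rw [Finset.card_eq_zero.1 hs, Finset.sum_empty]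
    positivity
  | succ n ih =>
    intro s hs hsep hx
    have hne : s.Nonempty := by rw [← Finset.card_pos, hs]; exact n.succ_pos
    obtain ⟨k, hk, hmax⟩ := s.exists_max_image (fun y => dist y x) hne
    have hcard := card_le_of_separated_of_subset_closedBall hρ (hx k hk) hsep hmax
    rw [hs] at hcard
    have hr0 : 0 < dist k x := hρ.trans_le (hx k hk)
    have hN : (0 : ℝ) < ((n + 1 : ℕ) : ℝ) := by positivity
    have hroot : ((n + 1 : ℕ) : ℝ) ^ (1 / (finrank ℝ E : ℝ)) ≤ 3 * dist k x / ρ := by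
      rw [one_div]
      calc _ ≤ ((3 * dist k x / ρ) ^ finrank ℝ E) ^ ((finrank ℝ E : ℝ)⁻¹) :=
            Real.rpow_le_rpow hN.le hcard (by positivity)
        _ = _ := Real.pow_rpow_inv_natCast (by positivity) hD'
    have hk' : dist k x ^ (-α) ≤ (ρ / 3) ^ (-α) * ((n + 1 : ℕ) : ℝ) ^ (β - 1) := by
      have h1 : ρ / 3 * ((n + 1 : ℕ) : ℝ) ^ (1 / (finrank ℝ E : ℝ)) ≤ dist k x := by
        rw [le_div_iff₀ hρ] at hroot
        linarith
      calc dist k x ^ (-α) ≤ (ρ / 3 * ((n + 1 : ℕ) : ℝ) ^ (1 / (finrank ℝ E : ℝ))) ^ (-α) :=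
            Real.rpow_le_rpow_of_nonpos (by positivity) h1 (by linarith)
        _ = _ := by
            rw [Real.mul_rpow (by positivity) (by positivity), ← Real.rpow_mul hN.le]
            congr 2
            rw [hβ]; ring
    have herase := ih (s.erase k) (by rw [Finset.card_erase_of_mem hk, hs]; rfl)
      (fun y hy z hz => hsep y (Finset.mem_of_mem_erase hy) z (Finset.mem_of_mem_erase hz))
      (fun y hy => hx y (Finset.mem_of_mem_erase hy))
    have hbern : (n : ℝ) ^ β ≤ ((n + 1 : ℕ) : ℝ) ^ β - β * ((n + 1 : ℕ) : ℝ) ^ (β - 1) := by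
      have h1 := _root_.rpow_one_add_le_one_add_mul_self (s := -(1 / ((n + 1 : ℕ) : ℝ)))
        (by
          rw [neg_le_neg_iff, div_le_one hN]; push_cast; linarith [n.cast_nonneg (α := ℝ)])
        hβ0.le hβ1
      have h2 : 1 + -(1 / ((n + 1 : ℕ) : ℝ)) = n / ((n + 1 : ℕ) : ℝ) := by
        field_simp; push_cast; ring
      rw [h2, Real.div_rpow n.cast_nonneg hN.le, div_le_iff₀ (by positivity)] at h1
      refine h1.trans_eq ?_
      rw [Real.rpow_sub_one hN.ne']
      ring
    rw [← Finset.sum_erase_add _ _ hk]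
    calc _ ≤ (ρ / 3) ^ (-α) / β * (n : ℝ) ^ β +
          (ρ / 3) ^ (-α) * ((n + 1 : ℕ) : ℝ) ^ (β - 1) := add_le_add herase hk'
      _ ≤ (ρ / 3) ^ (-α) / β * (((n + 1 : ℕ) : ℝ) ^ β - β * ((n + 1 : ℕ) : ℝ) ^ (β - 1)) +
          (ρ / 3) ^ (-α) * ((n + 1 : ℕ) : ℝ) ^ (β - 1) := by gcongr
      _ = _ := by field_simp; ring

end Packing

section Kernel

/-- The power law kernel `r ^ (-α)`, cut off at the distance `ρ`. -/
def powerKernel {V : Type*} [Dist V] (ρ α : ℝ) (x y : V) : ℝ := max ρ (dist x y) ^ (-α)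

variable {V : Type*} [PseudoMetricSpace V] {ρ α : ℝ}

theorem powerKernel_pos (hρ : 0 < ρ) (x y : V) : 0 < powerKernel ρ α x y :=
  Real.rpow_pos_of_pos (lt_max_of_lt_left hρ) _

theorem powerKernel_comm (x y : V) : powerKernel ρ α x y = powerKernel ρ α y x := by
  rw [powerKernel, powerKernel, dist_comm]

theorem powerKernel_le (hα : 0 ≤ α) {r : ℝ} (hr : 0 < r) {x y : V} (h : r ≤ dist x y) :
    powerKernel ρ α x y ≤ r ^ (-α) :=
  Real.rpow_le_rpow_of_nonpos hr (h.trans (le_max_right _ _)) (by linarith)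

theorem powerKernel_le_two_rpow_mul (hρ : 0 < ρ) (hα : 0 ≤ α) {x y z w : V}
    (h : max ρ (dist x y) ≤ 2 * max ρ (dist z w)) :
    powerKernel ρ α z w ≤ 2 ^ α * powerKernel ρ α x y := by
  have h0 : 0 < max ρ (dist x y) := lt_max_of_lt_left hρ
  calc powerKernel ρ α z w ≤ (max ρ (dist x y) / 2) ^ (-α) :=
        Real.rpow_le_rpow_of_nonpos (by positivity) (by linarith) (by linarith)
    _ = _ := by
        rw [powerKernel, Real.div_rpow h0.le zero_le_two, Real.rpow_neg zero_le_two, div_inv_eq_mul,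
          mul_comm]

theorem powerKernel_mul_le (hρ : 0 < ρ) (hα : 0 ≤ α) (x k y : V) :
    powerKernel ρ α x k * powerKernel ρ α k y ≤
      2 ^ α * powerKernel ρ α x y * (powerKernel ρ α x k + powerKernel ρ α k y) := by
  have hxk := powerKernel_pos (α := α) hρ x k
  have hky := powerKernel_pos (α := α) hρ k y
  have hxy := powerKernel_pos (α := α) hρ x y
  have htri : max ρ (dist x y) ≤ max ρ (dist x k) + max ρ (dist k y) :=
    max_le (by linarith [le_max_left ρ (dist x k), le_max_left ρ (dist k y)])
      ((dist_triangle x k y).trans (add_le_add (le_max_right _ _) (le_max_right _ _)))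
  have h2 : (0 : ℝ) < 2 ^ α := by positivity
  rw [mul_add]
  rcases le_total (max ρ (dist x k)) (max ρ (dist k y)) with h | h
  · have := powerKernel_le_two_rpow_mul (x := x) (y := y) (z := k) (w := y) hρ hα (by linarith)
    calc _ ≤ powerKernel ρ α x k * (2 ^ α * powerKernel ρ α x y) := by gcongr
      _ = 2 ^ α * powerKernel ρ α x y * powerKernel ρ α x k := by ring
      _ ≤ _ := le_add_of_nonneg_right (by positivity)
  · have := powerKernel_le_two_rpow_mul (x := x) (y := y) (z := x) (w := k) hρ hα (by linarith)
    calc _ ≤ (2 ^ α * powerKernel ρ α x y) * powerKernel ρ α k y := by gcongr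
      _ ≤ _ := le_add_of_nonneg_left (by positivity)

/-- The power law kernel is reproducing. -/
theorem sum_powerKernel_mul_le [Fintype V] (hρ : 0 < ρ) (hα : 0 ≤ α) {P : ℝ}
    (hP : ∀ x : V, ∑ k, powerKernel ρ α x k ≤ P) (x y : V) :
    ∑ k, powerKernel ρ α x k * powerKernel ρ α k y ≤ 2 * 2 ^ α * P * powerKernel ρ α x y := by
  have hxy := powerKernel_pos (α := α) hρ x y
  calc _ ≤ ∑ k, 2 ^ α * powerKernel ρ α x y * (powerKernel ρ α x k + powerKernel ρ α k y) :=
        Finset.sum_le_sum fun k _ => powerKernel_mul_le hρ hα x k y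
    _ = 2 ^ α * powerKernel ρ α x y *
          (∑ k, powerKernel ρ α x k + ∑ k, powerKernel ρ α y k) := by
        rw [← Finset.mul_sum, Finset.sum_add_distrib]
        simp only [powerKernel_comm y]
    _ ≤ 2 ^ α * powerKernel ρ α x y * (P + P) := by gcongr <;> exact hP _
    _ = _ := by ring

end Kernel

/-- The row sums of the power law kernel on `N` separated points are `O(N ^ (1 - α / D))`. -/
theorem sum_powerKernel_le {E : Type*} [NormedAddCommGroup E] [NormedSpace ℝ E]
    [FiniteDimensional ℝ E] {ρ α : ℝ} (hρ : 0 < ρ) (hα₀ : 0 ≤ α) (hα : α < finrank ℝ E)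
    (s : Finset E) (hsep : ∀ y ∈ s, ∀ z ∈ s, y ≠ z → ρ ≤ dist y z) (x : s) :
    ∑ k : s, powerKernel ρ α x k ≤
      (ρ ^ (-α) + (ρ / 3) ^ (-α) / (1 - α / finrank ℝ E)) *
        (s.card : ℝ) ^ (1 - α / finrank ℝ E) := by
  classical
  have hD : (0 : ℝ) < finrank ℝ E := hα₀.trans_lt hα
  have hβ0 : 0 < 1 - α / finrank ℝ E := by rw [sub_pos, div_lt_one hD]; exact hα
  have hc : 0 < (ρ / 3) ^ (-α) := Real.rpow_pos_of_pos (by linarith) _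
  have hc' : 0 < ρ ^ (-α) := Real.rpow_pos_of_pos hρ _
  have hcard : 1 ≤ s.card := Finset.card_pos.2 ⟨x, x.2⟩
  have h1 : (1 : ℝ) ≤ (s.card : ℝ) ^ (1 - α / finrank ℝ E) :=
    Real.one_le_rpow (by exact_mod_cast hcard) hβ0.le
  have hsum : ∑ k : s, powerKernel ρ α x k = ∑ k ∈ s, max ρ (dist (x : E) k) ^ (-α) :=
    Finset.sum_coe_sort s fun k => max ρ (dist (x : E) k) ^ (-α)
  rw [hsum, ← Finset.sum_erase_add _ _ x.2, dist_self, max_eq_left hρ.le, add_comm, add_mul]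
  refine add_le_add (le_mul_of_one_le_right hc'.le h1) ?_
  have h2 := sum_dist_rpow_neg_le hρ hα₀ hα (x : E) _ (s.erase x) rfl
    (fun y hy z hz => hsep y (Finset.mem_of_mem_erase hy) z (Finset.mem_of_mem_erase hz))
    (fun y hy => hsep y (Finset.mem_of_mem_erase hy) x x.2 (Finset.ne_of_mem_erase hy))
  calc _ = ∑ y ∈ s.erase x, dist y (x : E) ^ (-α) := by
        refine Finset.sum_congr rfl fun y hy => ?_
        rw [dist_comm, max_eq_right
          (hsep y (Finset.mem_of_mem_erase hy) x x.2 (Finset.ne_of_mem_erase hy))]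
    _ ≤ _ := h2
    _ ≤ _ := by
        gcongr
        exact Finset.erase_subset _ _

end LongRange

end

noncomputable section

namespace LongRange

open MeasureTheory Set

/-- A Gronwall inequality for a system of integral inequalities, with supersolution
`exp (lam * t) * φ`. -/
theorem le_add_exp_mul_of_integral_le {V : Type*} [Fintype V] {g : V → ℝ → ℝ} {w : V → V → ℝ}
    {φ : V → ℝ} {lam c T : ℝ} (hw : ∀ x y, 0 ≤ w x y) (hφ : ∀ x, 0 < φ x)
    (hlam : ∀ x, ∑ y, w x y * (φ x + φ y) ≤ lam * φ x) (hlam0 : 0 ≤ lam) (hc : 0 ≤ c)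
    (hg0 : ∀ x, 0 ≤ g x 0) (hgc : ∀ x, g x 0 ≤ c * φ x)
    (hcont : ∀ x, ContinuousOn (g x) (Icc 0 T))
    (hg : ∀ x, ∀ t ∈ Icc 0 T,
      g x t ≤ g x 0 + ∫ s in (0 : ℝ)..t, ∑ y, w x y * (g x s + g y s))
    {t : ℝ} (ht : t ∈ Icc 0 T) (x : V) :
    g x t ≤ g x 0 + c * (Real.exp (lam * t) - 1) * φ x := by
  have hbdd : ∃ G : ℝ, 0 ≤ G ∧ ∀ x, ∀ s ∈ Icc 0 T, g x s ≤ G * φ x := by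
    have h1 : ∀ x, ∃ G : ℝ, 0 ≤ G ∧ ∀ s ∈ Icc 0 T, g x s ≤ G * φ x := fun x => by
      obtain ⟨C, hC⟩ := isCompact_Icc.exists_bound_of_continuousOn (hcont x)
      refine ⟨|C| / φ x, div_nonneg (abs_nonneg _) (hφ x).le, fun s hs => ?_⟩
      rw [div_mul_cancel₀ _ (hφ x).ne']
      exact ((le_abs_self _).trans (hC s hs)).trans (le_abs_self _)
    choose G hG0 hG using h1
    refine ⟨∑ x, G x, Finset.sum_nonneg fun x _ => hG0 x, fun x s hs => (hG x s hs).trans ?_⟩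
    exact mul_le_mul_of_nonneg_right
      (Finset.single_le_sum (fun y _ => hG0 y) (Finset.mem_univ x)) (hφ x).le
  obtain ⟨G, hG0, hG⟩ := hbdd
  have hiter : ∀ n : ℕ, ∀ x, ∀ s ∈ Icc 0 T,
      g x s ≤ g x 0 + (c * (Real.exp (lam * s) - 1) + G * ((lam * s) ^ n / n.factorial)) * φ x := by
    intro n
    induction n with
    | zero =>
      intro x s hs
      have h1 : 0 ≤ Real.exp (lam * s) - 1 := by
        linarith [Real.one_le_exp (mul_nonneg hlam0 hs.1)]
      have h2 : 0 ≤ c * (Real.exp (lam * s) - 1) * φ x :=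
        mul_nonneg (mul_nonneg hc h1) (hφ x).le
      simp only [pow_zero, Nat.factorial_zero, Nat.cast_one, div_one, mul_one, add_mul]
      linarith [hG x s hs, hg0 x]
    | succ n ih =>
      intro x s hs
      have hsub : Icc 0 s ⊆ Icc 0 T := Icc_subset_Icc_right hs.2
      have hstep : ∀ r ∈ Icc 0 s, ∑ y, w x y * (g x r + g y r) ≤
          (c * Real.exp (lam * r) + G * ((lam * r) ^ n / n.factorial)) * (lam * φ x) := by
        intro r hr
        have h0 : 0 ≤ c * Real.exp (lam * r) + G * ((lam * r) ^ n / n.factorial) := by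
          have := mul_nonneg hlam0 hr.1
          positivity
        have h1 : ∀ y, g y r ≤
            (c * Real.exp (lam * r) + G * ((lam * r) ^ n / n.factorial)) * φ y := by
          intro y
          linarith [ih y r (hsub hr), hgc y]
        calc _ ≤ ∑ y, (c * Real.exp (lam * r) + G * ((lam * r) ^ n / n.factorial)) *
                (w x y * (φ x + φ y)) := Finset.sum_le_sum fun y _ => by
              rw [mul_left_comm]
              exact mul_le_mul_of_nonneg_left (by linarith [h1 x, h1 y]) (hw x y)
          _ ≤ _ := by
              rw [← Finset.mul_sum]
              exact mul_le_mul_of_nonneg_left (hlam x) h0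
      have hcl : ContinuousOn (fun r => ∑ y, w x y * (g x r + g y r)) (Icc 0 s) :=
        continuousOn_finsetSum _ fun y _ =>
          continuousOn_const.mul (((hcont x).mono hsub).add ((hcont y).mono hsub))
      have hder : ∀ r ∈ uIcc 0 s, HasDerivAt
          (fun r => (c * Real.exp (lam * r) +
            G * ((lam * r) ^ (n + 1) / (n + 1).factorial)) * φ x)
          ((c * Real.exp (lam * r) + G * ((lam * r) ^ n / n.factorial)) * (lam * φ x)) r := by
        intro r _
        have hl : HasDerivAt (fun r => lam * r) lam r := by
          simpa using (hasDerivAt_id r).const_mul lam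
        have h1 := (((hl.exp.const_mul c).add
          (((hl.pow (n + 1)).div_const ((n + 1).factorial : ℝ)).const_mul G)).mul_const (φ x))
        refine h1.congr_deriv ?_
        rw [Nat.factorial_succ]
        push_cast
        field_simp
      have hcr : Continuous fun r =>
          (c * Real.exp (lam * r) + G * ((lam * r) ^ n / n.factorial)) * (lam * φ x) := by
        fun_prop
      calc g x s ≤ g x 0 + ∫ r in (0 : ℝ)..s, ∑ y, w x y * (g x r + g y r) := hg x s hs
        _ ≤ g x 0 + ∫ r in (0 : ℝ)..s,
              (c * Real.exp (lam * r) + G * ((lam * r) ^ n / n.factorial)) * (lam * φ x) := by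
            refine add_le_add_right (intervalIntegral.integral_mono_on hs.1 ?_
              (hcr.intervalIntegrable _ _) hstep) _
            exact ContinuousOn.intervalIntegrable (by rwa [uIcc_of_le hs.1])
        _ = _ := by
            rw [intervalIntegral.integral_eq_sub_of_hasDerivAt hder
              (hcr.intervalIntegrable _ _)]
            simp only [mul_zero, Real.exp_zero, ne_eq, Nat.add_eq_zero_iff, one_ne_zero, and_false,
              not_false_eq_true, zero_pow, zero_div, add_zero, mul_one]
            ring
  have hlim : Filter.Tendsto
      (fun n : ℕ => g x 0 +
        (c * (Real.exp (lam * t) - 1) + G * ((lam * t) ^ n / n.factorial)) * φ x)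
      Filter.atTop (nhds (g x 0 + (c * (Real.exp (lam * t) - 1) + G * 0) * φ x)) :=
    (((FloorSemiring.tendsto_pow_div_factorial_atTop (lam * t)).const_mul G).const_add
      _).mul_const _ |>.const_add _
  have := ge_of_tendsto' hlim fun n => hiter n x t ht
  simpa using this

theorem intervalIntegrable_sum {E ι : Type*} [NormedAddCommGroup E] (S : Finset ι)
    {f : ι → ℝ → E} {T : ℝ}
    (hf : ∀ i ∈ S, IntervalIntegrable (f i) volume 0 T) :
    IntervalIntegrable (fun t => ∑ i ∈ S, f i t) volume 0 T := by
  have := IntervalIntegrable.sum S hf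
  simpa only [Finset.sum_fn] using this

section Interaction

variable {V : Type*} [Fintype V] [DecidableEq V] [Dist V] {d : V → ℕ} {α : ℝ}

namespace PowerLawHamiltonian

variable (h : PowerLawHamiltonian d α)

/-- The interactions of the site `x` with the other sites. -/
def interactionsAt (x : V) (t : ℝ) : Op d := ∑ y ∈ Finset.univ.erase x, h.pair s(x, y) t

/-- The Hamiltonian without the interactions of the site `x` with the other sites. -/
def decoupledAt (x : V) (t : ℝ) : Op d :=
  ∑ i, h.onsite i t + ∑ e : Sym2 V with ¬ e.IsDiag ∧ x ∉ e, h.pair e t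

theorem total_eq_decoupledAt_add (x : V) (t : ℝ) :
    h.total t = h.decoupledAt x t + h.interactionsAt x t := by
  have himage : (Finset.univ.filter fun e : Sym2 V => ¬ e.IsDiag ∧ x ∈ e) =
      (Finset.univ.erase x).image fun y => s(x, y) := by
    ext e
    simp only [Finset.mem_filter, Finset.mem_univ, true_and, Finset.mem_image, Finset.mem_erase,
      and_true]
    constructor
    · rintro ⟨h1, y, rfl⟩
      exact ⟨y, fun hyx => h1 (by simp [hyx]), rfl⟩
    · rintro ⟨y, hy, rfl⟩
      exact ⟨by simpa using hy.symm, by simp⟩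
  have hinter : h.interactionsAt x t = ∑ e : Sym2 V with ¬ e.IsDiag ∧ x ∈ e, h.pair e t := by
    rw [himage, Finset.sum_image, interactionsAt]
    intro y _ z _ hyz
    exact Sym2.congr_right.1 hyz
  rw [total, decoupledAt, hinter, add_assoc, ← Finset.filter_filter, ← Finset.filter_filter,
    add_comm (∑ e ∈ Finset.filter (fun e => x ∉ e) _, h.pair e t),
    Finset.sum_filter_add_sum_filter_not]

theorem intervalIntegrable_pair {e : Sym2 V} (he : ¬ e.IsDiag) {T : ℝ} (hT : 0 ≤ T) :
    IntervalIntegrable (h.pair e) volume 0 T := by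
  induction e with
  | _ i j => exact h.pair_integrable i j (by simpa using he) T hT

theorem isSelfAdjoint_pair {e : Sym2 V} (he : ¬ e.IsDiag) {t : ℝ} (ht : 0 ≤ t) :
    IsSelfAdjoint (h.pair e t) := by
  induction e with
  | _ i j => exact h.pair_selfAdjoint i j (by simpa using he) t ht

theorem trivialAt_pair {e : Sym2 V} (he : ¬ e.IsDiag) {x : V} (hx : x ∉ e) {t : ℝ} (ht : 0 ≤ t) :
    TrivialAt x (h.pair e t) := by
  induction e with
  | _ i j =>
    exact (h.pair_supported i j (by simpa using he) t ht).trivialAt (by simpa using hx)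

theorem intervalIntegrable_total {T : ℝ} (hT : 0 ≤ T) :
    IntervalIntegrable h.total volume 0 T :=
  (intervalIntegrable_sum _ fun i _ => h.onsite_integrable i T hT).add
    (intervalIntegrable_sum _ fun _ he => h.intervalIntegrable_pair (Finset.mem_filter.1 he).2 hT)

theorem intervalIntegrable_decoupledAt (x : V) {T : ℝ} (hT : 0 ≤ T) :
    IntervalIntegrable (h.decoupledAt x) volume 0 T :=
  (intervalIntegrable_sum _ fun i _ => h.onsite_integrable i T hT).add
    (intervalIntegrable_sum _ fun _ he =>
      h.intervalIntegrable_pair (Finset.mem_filter.1 he).2.1 hT)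

theorem intervalIntegrable_interactionsAt (x : V) {T : ℝ} (hT : 0 ≤ T) :
    IntervalIntegrable (h.interactionsAt x) volume 0 T :=
  intervalIntegrable_sum _ fun _ hy =>
    h.pair_integrable _ _ (Finset.ne_of_mem_erase hy).symm T hT

theorem isSelfAdjoint_total {t : ℝ} (ht : 0 ≤ t) : IsSelfAdjoint (h.total t) :=
  (isSelfAdjoint_sum _ fun i _ => h.onsite_selfAdjoint i t ht).add
    (isSelfAdjoint_sum _ fun _ he => h.isSelfAdjoint_pair (Finset.mem_filter.1 he).2 ht)

theorem isSelfAdjoint_decoupledAt (x : V) {t : ℝ} (ht : 0 ≤ t) :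
    IsSelfAdjoint (h.decoupledAt x t) :=
  (isSelfAdjoint_sum _ fun i _ => h.onsite_selfAdjoint i t ht).add
    (isSelfAdjoint_sum _ fun _ he => h.isSelfAdjoint_pair (Finset.mem_filter.1 he).2.1 ht)

theorem siteDefect_commutator_decoupledAt (x : V) {t : ℝ} (ht : 0 ≤ t) (W : Op d) :
    siteDefect x (h.decoupledAt x t * W - W * h.decoupledAt x t) =
      h.decoupledAt x t * siteDefect x W - siteDefect x W * h.decoupledAt x t := by
  have hon : ∀ i, siteDefect x (h.onsite i t * W - W * h.onsite i t) =
      h.onsite i t * siteDefect x W - siteDefect x W * h.onsite i t := by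
    intro i
    have hs := h.onsite_supported i t ht
    by_cases hi : i = x
    · subst hi; exact hs.siteDefect_commutator W
    · exact (hs.trivialAt (by simpa using Ne.symm hi)).siteDefect_commutator W
  have hpair : TrivialAt x (∑ e : Sym2 V with ¬ e.IsDiag ∧ x ∉ e, h.pair e t) :=
    TrivialAt.sum fun e he => h.trivialAt_pair (Finset.mem_filter.1 he).2.1
      (Finset.mem_filter.1 he).2.2 ht
  have hsplit : ∀ A B C : Op d, (A + B) * C - C * (A + B) = (A * C - C * A) + (B * C - C * B) :=
    fun A B C => by noncomm_ring
  rw [decoupledAt, hsplit, hsplit, map_add, hpair.siteDefect_commutator]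
  congr 1
  simp only [Finset.sum_mul, Finset.mul_sum, ← Finset.sum_sub_distrib, map_sum, hon]

theorem norm_siteDefect_commutator_interactionsAt_le (x : V) {t : ℝ} (ht : 0 ≤ t) (W : Op d) :
    ‖siteDefect x (h.interactionsAt x t * W - W * h.interactionsAt x t)‖ ≤
      ∑ y ∈ Finset.univ.erase x,
        4 * (1 / dist x y ^ α) * (‖siteDefect x W‖ + ‖siteDefect y W‖) := by
  rw [interactionsAt, Finset.sum_mul, Finset.mul_sum, ← Finset.sum_sub_distrib, map_sum]
  refine norm_sum_le_of_le _ fun y hy => ?_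
  have hxy : x ≠ y := (Finset.ne_of_mem_erase hy).symm
  have h1 := (h.pair_supported x y hxy t ht).norm_commutator_le W
  rw [Finset.sum_pair hxy] at h1
  calc _ ≤ 2 * ‖h.pair s(x, y) t * W - W * h.pair s(x, y) t‖ := norm_siteDefect_le _ _
    _ ≤ 2 * (2 * ‖h.pair s(x, y) t‖ * (‖siteDefect x W‖ + ‖siteDefect y W‖)) := by gcongr
    _ ≤ 2 * (2 * (1 / dist x y ^ α) * (‖siteDefect x W‖ + ‖siteDefect y W‖)) := by
        gcongr; exact h.pair_norm_le x y hxy t ht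
    _ = _ := by ring

/-- The operator `B` evolved backwards in time, `U(t) B U(t)†`. -/
def evolved (B : Op d) (t : ℝ) : Op d :=
  timeEvolution h.total t * B * star (timeEvolution h.total t)

theorem isPrimitiveOn_evolved (B : Op d) {T : ℝ} (hT : 0 ≤ T) :
    IsPrimitiveOn (h.evolved B)
      (fun t => (-Complex.I) • (h.total t * h.evolved B t - h.evolved B t * h.total t)) T :=
  isPrimitiveOn_conj_timeEvolution hT (h.intervalIntegrable_total hT)
    (fun _ ht => h.isSelfAdjoint_total ht.1) B

theorem evolved_zero (B : Op d) : h.evolved B 0 = B := by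
  rw [evolved, timeEvolution_zero, star_one, one_mul, mul_one]

/-- `siteDefect` as a real continuous linear map. -/
def siteDefectL (x : V) : Op d →L[ℝ] Op d :=
  (LinearMap.toContinuousLinearMap (siteDefect (d := d) x)).restrictScalars ℝ

theorem continuousOn_norm_siteDefect_evolved (B : Op d) (x : V) {T : ℝ} (hT : 0 ≤ T) :
    ContinuousOn (fun t => ‖siteDefect x (h.evolved B t)‖) (Icc 0 T) :=
  ((siteDefectL (d := d) x).continuous.comp_continuousOn
    ((h.isPrimitiveOn_evolved B hT).continuousOn hT)).norm

theorem norm_siteDefect_evolved_le (B : Op d) (x : V) {t : ℝ} (ht : 0 ≤ t) :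
    ‖siteDefect x (h.evolved B t)‖ ≤ ‖siteDefect x B‖ +
      ∫ s in (0 : ℝ)..t, ∑ y ∈ Finset.univ.erase x, 4 * (1 / dist x y ^ α) *
        (‖siteDefect x (h.evolved B s)‖ + ‖siteDefect y (h.evolved B s)‖) := by
  set W := h.evolved B with hW
  have hprim := h.isPrimitiveOn_evolved B ht
  rw [← hW] at hprim
  have hWc := hprim.continuousOn ht
  rw [← uIcc_of_le ht] at hWc
  have hR := h.intervalIntegrable_interactionsAt x ht
  set S : ℝ → Op d := fun s => (-Complex.I) •
    siteDefect x (h.interactionsAt x s * W s - W s * h.interactionsAt x s) with hS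
  have hD : IsPrimitiveOn (fun s => siteDefect x (W s))
      (fun s => (-Complex.I) • (h.decoupledAt x s * siteDefect x (W s) -
        siteDefect x (W s) * h.decoupledAt x s) + S s) t := by
    refine (hprim.map (siteDefectL (d := d) x)).congr_right ht fun s hs => ?_
    change siteDefect x ((-Complex.I) • (h.total s * W s - W s * h.total s)) = _
    rw [hS, map_smul, ← smul_add, ← h.siteDefect_commutator_decoupledAt x hs.1, ← map_add,
      h.total_eq_decoupledAt_add x s]
    congr 2
    noncomm_ring
  have hSint : IntervalIntegrable S volume 0 t := by
    have h1 : IntervalIntegrable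
        (fun s => h.interactionsAt x s * W s - W s * h.interactionsAt x s) volume 0 t :=
      (hR.mul_continuousOn hWc).sub (hR.continuousOn_mul hWc)
    have h2 : IntervalIntegrable (fun s => siteDefectL (d := d) x
        (h.interactionsAt x s * W s - W s * h.interactionsAt x s)) volume 0 t :=
      ⟨(siteDefectL (d := d) x).integrable_comp h1.1,
        (siteDefectL (d := d) x).integrable_comp h1.2⟩
    exact ⟨h2.1.smul (-Complex.I), h2.2.smul (-Complex.I)⟩
  have hmain := norm_le_of_commutator_equation ht (h.intervalIntegrable_decoupledAt x ht)
    (fun s hs => h.isSelfAdjoint_decoupledAt x hs.1) hD ⟨ht, le_rfl⟩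
  have hW0 : W 0 = B := h.evolved_zero B
  rw [hW0] at hmain
  refine hmain.trans (add_le_add_right (intervalIntegral.integral_mono_on ht hSint.norm ?_ ?_) _)
  · refine ContinuousOn.intervalIntegrable ?_
    rw [uIcc_of_le ht]
    exact continuousOn_finsetSum _ fun y _ => continuousOn_const.mul
      ((h.continuousOn_norm_siteDefect_evolved B x ht).add
        (h.continuousOn_norm_siteDefect_evolved B y ht))
  · intro s hs
    rw [hS, norm_smul, norm_neg, Complex.norm_I, one_mul]
    exact h.norm_siteDefect_commutator_interactionsAt_le x hs.1 (W s)

end PowerLawHamiltonian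

end Interaction

end LongRange

end

noncomputable section

namespace LongRange

section LightCone

variable {V : Type*} [MetricSpace V] {α ρ P : ℝ}

theorem one_div_dist_rpow_eq_powerKernel (hsep : ∀ x y : V, x ≠ y → ρ ≤ dist x y) {x y : V}
    (hxy : x ≠ y) : 1 / dist x y ^ α = powerKernel ρ α x y := by
  rw [powerKernel, max_eq_right (hsep x y hxy), Real.rpow_neg dist_nonneg, one_div]

/-- The spatial profile of the spreading of an operator supported on `Y`. -/
def spreadProfile [DecidableEq V] (ρ α P : ℝ) (Y : Finset V) (x : V) : ℝ :=
  (if x ∈ Y then 1 else 0) + P⁻¹ * ∑ y ∈ Y, powerKernel ρ α x y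

theorem spreadProfile_pos [DecidableEq V] (hρ : 0 < ρ) (hP : 0 < P) {Y : Finset V}
    (hY : Y.Nonempty) (x : V) : 0 < spreadProfile ρ α P Y x :=
  add_pos_of_nonneg_of_pos (by split_ifs <;> norm_num)
    (mul_pos (inv_pos.2 hP) (Finset.sum_pos (fun y _ => powerKernel_pos hρ x y) hY))

variable [Fintype V] [DecidableEq V] {d : V → ℕ}

theorem sum_powerKernel_mul_spreadProfile_le (hρ : 0 < ρ) (hα : 0 ≤ α) (hP0 : 0 < P)
    (hP : ∀ x : V, ∑ k, powerKernel ρ α x k ≤ P) (Y : Finset V) (x : V) :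
    ∑ y, powerKernel ρ α x y * spreadProfile ρ α P Y y ≤
      (1 + 2 * 2 ^ α) * P * spreadProfile ρ α P Y x := by
  have h0 : ∀ y, 0 ≤ powerKernel ρ α x y := fun y => (powerKernel_pos hρ x y).le
  have hsum0 : 0 ≤ ∑ y ∈ Y, powerKernel ρ α x y := Finset.sum_nonneg fun y _ => h0 y
  have h1 : ∑ y, powerKernel ρ α x y * spreadProfile ρ α P Y y =
      ∑ y ∈ Y, powerKernel ρ α x y +
        P⁻¹ * ∑ y ∈ Y, ∑ k, powerKernel ρ α x k * powerKernel ρ α k y := by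
    simp only [spreadProfile, mul_add, Finset.sum_add_distrib, mul_ite, mul_one, mul_zero,
      Finset.sum_ite_mem, Finset.univ_inter]
    congr 1
    rw [Finset.sum_comm, Finset.mul_sum]
    refine Finset.sum_congr rfl fun k _ => ?_
    rw [← Finset.mul_sum]
    ring
  have h2 : P⁻¹ * ∑ y ∈ Y, ∑ k, powerKernel ρ α x k * powerKernel ρ α k y ≤
      2 * 2 ^ α * ∑ y ∈ Y, powerKernel ρ α x y := by
    rw [inv_mul_le_iff₀ hP0, Finset.mul_sum, Finset.mul_sum]
    refine Finset.sum_le_sum fun y _ => (sum_powerKernel_mul_le hρ hα hP x y).trans_eq ?_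
    ring
  have h3 : P⁻¹ * ∑ y ∈ Y, powerKernel ρ α x y ≤ spreadProfile ρ α P Y x :=
    le_add_of_nonneg_left (by split_ifs <;> norm_num)
  rw [inv_mul_le_iff₀ hP0] at h3
  calc _ ≤ (1 + 2 * 2 ^ α) * ∑ y ∈ Y, powerKernel ρ α x y := by rw [h1]; linarith
    _ ≤ (1 + 2 * 2 ^ α) * (P * spreadProfile ρ α P Y x) := by gcongr
    _ = _ := by ring

/-- A Lieb-Robinson bound for the parts of an evolved operator acting on a distant site. -/
theorem PowerLawHamiltonian.norm_siteDefect_evolved_le_exp (h : PowerLawHamiltonian d α)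
    (hρ : 0 < ρ) (hα : 0 ≤ α) (hP0 : 0 < P) (hP : ∀ x : V, ∑ k, powerKernel ρ α x k ≤ P)
    (hsep : ∀ x y : V, x ≠ y → ρ ≤ dist x y) {Y : Finset V} (hY : Y.Nonempty) {B : Op d}
    (hB : SupportedOn Y B) {x : V} (hx : x ∉ Y) {t : ℝ} (ht : 0 ≤ t) :
    ‖siteDefect x (h.evolved B t)‖ ≤ 2 * ‖B‖ *
      (Real.exp ((8 + 8 * 2 ^ α) * P * t) - 1) * (P⁻¹ * ∑ y ∈ Y, powerKernel ρ α x y) := by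
  have hK : ∀ x y : V, 0 ≤ powerKernel ρ α x y := fun x y => (powerKernel_pos hρ x y).le
  have hφ : ∀ x, 0 < spreadProfile ρ α P Y x := spreadProfile_pos hρ hP0 hY
  have hφ1 : ∀ x ∈ Y, 1 ≤ spreadProfile ρ α P Y x := fun x hx => by
    rw [spreadProfile, if_pos hx]
    exact le_add_of_nonneg_right
      (mul_nonneg (inv_nonneg.2 hP0.le) (Finset.sum_nonneg fun y _ => hK x y))
  have hdef : ∀ x ∉ Y, siteDefect x B = 0 := fun x hx => (hB.trivialAt hx).siteDefect_eq_zero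
  have h1 := le_add_exp_mul_of_integral_le
    (g := fun x t => ‖siteDefect x (h.evolved B t)‖)
    (w := fun x y => 4 * powerKernel ρ α x y) (φ := spreadProfile ρ α P Y)
    (lam := (8 + 8 * 2 ^ α) * P) (c := 2 * ‖B‖)
    (fun x y => mul_nonneg (by norm_num) (hK x y)) hφ
    (fun x => by
      have e : ∑ y, 4 * powerKernel ρ α x y *
          (spreadProfile ρ α P Y x + spreadProfile ρ α P Y y) =
          4 * ((∑ y, powerKernel ρ α x y) * spreadProfile ρ α P Y x +
            ∑ y, powerKernel ρ α x y * spreadProfile ρ α P Y y) := by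
        rw [Finset.sum_mul, ← Finset.sum_add_distrib, Finset.mul_sum]
        exact Finset.sum_congr rfl fun y _ => by ring
      rw [e]
      have e1 := mul_le_mul_of_nonneg_right (hP x) (hφ x).le
      have e2 := sum_powerKernel_mul_spreadProfile_le hρ hα hP0 hP Y x
      linarith)
    (by positivity) (by positivity) (fun x => norm_nonneg _)
    (fun x => by
      rw [h.evolved_zero]
      by_cases hxY : x ∈ Y
      · exact (norm_siteDefect_le x B).trans
          (le_mul_of_one_le_right (by positivity) (hφ1 x hxY))
      · rw [hdef x hxY, norm_zero]
        exact mul_nonneg (by positivity) (hφ x).le)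
    (fun x => h.continuousOn_norm_siteDefect_evolved B x ht)
    (fun x s hs => by
      have hcont : ∀ S : Finset V, ∀ w : V → ℝ, IntervalIntegrable (fun r => ∑ y ∈ S, w y *
          (‖siteDefect x (h.evolved B r)‖ + ‖siteDefect y (h.evolved B r)‖))
          MeasureTheory.volume 0 s := fun S w => by
        refine ContinuousOn.intervalIntegrable ?_
        rw [Set.uIcc_of_le hs.1]
        exact continuousOn_finsetSum _ fun y _ => continuousOn_const.mul
          ((h.continuousOn_norm_siteDefect_evolved B x hs.1).add
            (h.continuousOn_norm_siteDefect_evolved B y hs.1))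
      have h2 := h.norm_siteDefect_evolved_le B x hs.1
      simp only [h.evolved_zero]
      refine h2.trans (add_le_add_right (intervalIntegral.integral_mono_on hs.1 (hcont _ _)
        (hcont _ _) fun r _ => ?_) _)
      calc _ = ∑ y ∈ Finset.univ.erase x, 4 * powerKernel ρ α x y *
            (‖siteDefect x (h.evolved B r)‖ + ‖siteDefect y (h.evolved B r)‖) :=
            Finset.sum_congr rfl fun y hy => by
              rw [one_div_dist_rpow_eq_powerKernel hsep (Finset.ne_of_mem_erase hy).symm]
        _ ≤ _ := Finset.sum_le_sum_of_subset_of_nonneg (Finset.subset_univ _) fun y _ _ =>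
            mul_nonneg (mul_nonneg (by norm_num) (hK x y)) (by positivity))
    ⟨ht, le_rfl⟩ x
  simp only [h.evolved_zero, hdef x hx, norm_zero, zero_add, spreadProfile, if_neg hx] at h1
  exact h1

/-- A Lieb-Robinson bound for commutators of distant operators. -/
theorem PowerLawHamiltonian.norm_commutator_heisenberg_le (h : PowerLawHamiltonian d α)
    (hρ : 0 < ρ) (hα : 0 ≤ α) (hP0 : 0 < P) (hP : ∀ x : V, ∑ k, powerKernel ρ α x k ≤ P)
    (hsep : ∀ x y : V, x ≠ y → ρ ≤ dist x y) {X Y : Finset V} {r : ℝ} (hr : 0 < r)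
    (hXY : ∀ x ∈ X, ∀ y ∈ Y, r ≤ dist x y) {A B : Op d} (hA : SupportedOn X A)
    (hB : SupportedOn Y B) {t : ℝ} (ht : 0 ≤ t) :
    ‖heisenberg h.total A t * B - B * heisenberg h.total A t‖ ≤
      4 * ‖A‖ * ‖B‖ * X.card * Y.card * (P⁻¹ * r ^ (-α)) *
        (Real.exp ((8 + 8 * 2 ^ α) * P * t) - 1) := by
  have hexp : 0 ≤ Real.exp ((8 + 8 * 2 ^ α) * P * t) - 1 := by
    have : 0 ≤ (8 + 8 * (2 : ℝ) ^ α) * P * t := by positivity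
    linarith [Real.one_le_exp this]
  rcases Y.eq_empty_or_nonempty with rfl | hY
  · have hcomm : Commute B (heisenberg h.total A t) := hB.commute (by simp)
    rw [hcomm.eq, sub_self, norm_zero]
    simp
  rw [heisenberg_commutator_norm_eq ht (h.intervalIntegrable_total ht)
    (fun s hs => h.isSelfAdjoint_total hs.1) A B ⟨ht, le_rfl⟩]
  have hsite : ∀ x ∈ X, ‖siteDefect x (h.evolved B t)‖ ≤ 2 * ‖B‖ *
      (Real.exp ((8 + 8 * 2 ^ α) * P * t) - 1) * (P⁻¹ * (Y.card * r ^ (-α))) := by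
    intro x hx
    have hxY : x ∉ Y := fun hy => by
      have := hXY x hx x hy
      rw [dist_self] at this
      linarith
    refine (h.norm_siteDefect_evolved_le_exp hρ hα hP0 hP hsep hY hB hxY ht).trans ?_
    have hsum : ∑ y ∈ Y, powerKernel ρ α x y ≤ Y.card * r ^ (-α) := by
      rw [← nsmul_eq_mul]
      exact Finset.sum_le_card_nsmul _ _ _ fun y hy => powerKernel_le hα hr (hXY x hx y hy)
    gcongr
  refine (hA.norm_commutator_le (h.evolved B t)).trans ?_
  calc _ ≤ 2 * ‖A‖ * (X.card * (2 * ‖B‖ * (Real.exp ((8 + 8 * 2 ^ α) * P * t) - 1) *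
        (P⁻¹ * (Y.card * r ^ (-α))))) := by
        gcongr
        rw [← nsmul_eq_mul]
        exact Finset.sum_le_card_nsmul _ _ _ hsite
    _ = _ := by ring

end LightCone

theorem mul_log_le_log_one_add_mul {ε N : ℝ} (hε0 : 0 ≤ ε) (hε1 : ε ≤ 1) (hN : 1 ≤ N) :
    ε * Real.log N ≤ Real.log (1 + ε * N) := by
  have h1 := rpow_one_add_le_one_add_mul_self (s := N - 1) (by linarith) hε0 hε1
  rw [add_sub_cancel] at h1
  rw [← Real.log_rpow (by linarith)]
  exact Real.log_le_log (by positivity) (by linarith)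

end LongRange

end

theorem mainTheorem4 (D : ℕ) (hD : 1 ≤ D) [DecidableEq (EuclideanSpace ℝ (Fin D))]
    (L : Submodule ℤ (EuclideanSpace ℝ (Fin D))) [DiscreteTopology L] [IsZLattice ℝ L]
    (α : ℝ) (hα₀ : 0 ≤ α) (hα : α < D)
    (δ : ℝ) (hδ : 0 < δ) (m : ℕ) (κ : ℝ) (hκ : 0 < κ) :
    ∃ c : ℝ, 0 < c ∧
      ∀ (Λ : Finset (EuclideanSpace ℝ (Fin D))), (Λ : Set (EuclideanSpace ℝ (Fin D))) ⊆ L →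
      ∀ (d : Λ → ℕ) (h : LongRange.PowerLawHamiltonian d α) (X Y : Finset Λ),
        X.card ≤ m → Y.card ≤ m →
        (∀ x ∈ X, ∀ y ∈ Y, κ * (Λ.card : ℝ) ^ (1 / (D : ℝ)) ≤ dist x y) →
        ENNReal.ofReal (c * (Real.log Λ.card / (Λ.card : ℝ) ^ (1 - α / D))) ≤
          LongRange.signalingTime h.total X Y δ := by
  obtain ⟨ρ, hρ, hsepL⟩ := LongRange.exists_pos_forall_le_dist L
  have hD0 : (0 : ℝ) < D := by exact_mod_cast hD
  have hβ0 : 0 < 1 - α / D := by rw [sub_pos, div_lt_one hD0]; exact hα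
  set K : ℝ := ρ ^ (-α) + (ρ / 3) ^ (-α) / (1 - α / D) with hK
  have hK0 : 0 < K := by
    have h1 : 0 < ρ ^ (-α) := Real.rpow_pos_of_pos hρ _
    have h2 : 0 < (ρ / 3) ^ (-α) := Real.rpow_pos_of_pos (by linarith) _
    positivity
  set q : ℝ := 4 * (m ^ 2 + 1) * (K⁻¹ * κ ^ (-α)) with hq
  have hq0 : 0 < q := by
    have : 0 < κ ^ (-α) := Real.rpow_pos_of_pos hκ _
    positivity
  set ε : ℝ := min 1 (δ / q) with hε
  have hε0 : 0 < ε := lt_min one_pos (div_pos hδ hq0)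
  set μ : ℝ := (8 + 8 * 2 ^ α) * K with hμ
  have hμ0 : 0 < μ := by positivity
  refine ⟨ε / μ, div_pos hε0 hμ0, fun Λ hΛ d h X Y hX hY hXY => ?_⟩
  refine le_iInf₂ fun t ⟨A, B, hA, hB, hA1, hB1, hAB⟩ => ?_
  rw [ENNReal.ofReal_le_iff_le_toReal ENNReal.coe_ne_top, ENNReal.coe_toReal]
  rcases Λ.card.eq_zero_or_pos with hN | hN
  · rw [hN]; simp
  have hN0 : (0 : ℝ) < Λ.card := by exact_mod_cast hN
  have hN1 : (1 : ℝ) ≤ Λ.card := by exact_mod_cast hN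
  set N : ℝ := (Λ.card : ℝ) with hNdef
  have hNβ : 0 < N ^ (1 - α / D) := Real.rpow_pos_of_pos hN0 _
  have hfr : Module.finrank ℝ (EuclideanSpace ℝ (Fin D)) = D := by simp
  have hsep : ∀ y ∈ Λ, ∀ z ∈ Λ, y ≠ z → ρ ≤ dist y z :=
    fun y hy z hz => hsepL y (hΛ hy) z (hΛ hz)
  have hP : ∀ x : Λ, ∑ k, LongRange.powerKernel ρ α x k ≤ K * N ^ (1 - α / D) := by
    intro x
    have := LongRange.sum_powerKernel_le hρ hα₀ (by rw [hfr]; exact hα) Λ hsep x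
    rwa [hfr] at this
  have hr : 0 < κ * N ^ (1 / (D : ℝ)) := mul_pos hκ (Real.rpow_pos_of_pos hN0 _)
  have hmain := h.norm_commutator_heisenberg_le hρ hα₀ (mul_pos hK0 hNβ) hP
    (fun x y hxy => hsep x x.2 y y.2 (Subtype.coe_ne_coe.2 hxy)) hr hXY hA hB t.2
  have hrα : (K * N ^ (1 - α / D))⁻¹ * (κ * N ^ (1 / (D : ℝ))) ^ (-α) =
      K⁻¹ * κ ^ (-α) * N⁻¹ := by
    rw [Real.mul_rpow hκ.le (by positivity), ← Real.rpow_mul hN0.le, mul_inv,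
      ← Real.rpow_neg hN0.le, ← Real.rpow_neg_one N]
    have : (-1 : ℝ) = -(1 - α / D) + 1 / (D : ℝ) * -α := by ring
    rw [this, Real.rpow_add hN0]
    ring
  rw [hA1, hB1, hrα] at hmain
  have hexp0 : 0 ≤ Real.exp ((8 + 8 * 2 ^ α) * (K * N ^ (1 - α / D)) * t) - 1 := by
    have h1 : 0 ≤ (8 + 8 * (2 : ℝ) ^ α) * (K * N ^ (1 - α / D)) * t := by positivity
    linarith [Real.one_le_exp h1]
  have hcard : (X.card : ℝ) * Y.card ≤ m ^ 2 + 1 := by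
    have h1 : (X.card : ℝ) ≤ m := by exact_mod_cast hX
    have h2 : (Y.card : ℝ) ≤ m := by exact_mod_cast hY
    have h3 : (X.card : ℝ) * Y.card ≤ m * m :=
      mul_le_mul h1 h2 (Nat.cast_nonneg _) (Nat.cast_nonneg _)
    linarith [sq (m : ℝ)]
  have hbound : δ < q * N⁻¹ * (Real.exp (μ * N ^ (1 - α / D) * t) - 1) := by
    refine (hAB.trans_le hmain).trans_le ?_
    have hκα : 0 ≤ K⁻¹ * κ ^ (-α) * N⁻¹ := by positivity
    rw [← mul_assoc (8 + 8 * (2 : ℝ) ^ α) K, ← hμ] at hexp0 ⊢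
    refine mul_le_mul_of_nonneg_right ?_ hexp0
    calc _ = 4 * ((X.card : ℝ) * Y.card) * (K⁻¹ * κ ^ (-α) * N⁻¹) := by ring
      _ ≤ 4 * (m ^ 2 + 1) * (K⁻¹ * κ ^ (-α) * N⁻¹) := by gcongr
      _ = _ := by rw [hq]; ring
  have hlt : 1 + ε * N ≤ Real.exp (μ * N ^ (1 - α / D) * t) := by
    have h1 : δ / q * N < Real.exp (μ * N ^ (1 - α / D) * t) - 1 := by
      rw [div_mul_eq_mul_div, div_lt_iff₀ hq0]
      rw [mul_assoc, ← div_eq_inv_mul, mul_div_assoc', lt_div_iff₀ hN0] at hbound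
      linarith
    have h2 : ε * N ≤ δ / q * N := by gcongr; exact min_le_right _ _
    linarith
  have hlog : ε * Real.log N ≤ μ * N ^ (1 - α / D) * t :=
    (LongRange.mul_log_le_log_one_add_mul hε0.le (min_le_left _ _) hN1).trans
      ((Real.log_le_log (by positivity) hlt).trans_eq (Real.log_exp _))
  rw [div_mul_div_comm, div_le_iff₀ (by positivity)]
  linarith
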